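/- Let $X$ be a compact metric space, $r:X\to X$ a Borel measurable map of $X$ onto $X$ with $r^{-1}(x)$ finite for every $x\in X$, and $\mu$ a Borel probability measure on $X$ that is strongly $r$-invariant, i.e. $\int_X f\,d\mu=\int_X\frac{1}{\#r^{-1}(x)}\sum_{r(y)=x}f(y)\,d\mu(x)$ for every bounded measurable $f$. Let $m_0\in L^\infty(X,\mu)$ be complex-valued and put $(R_{m_0}\xi)(x)=\frac{1}{\#r^{-1}(x)}\sum_{r(y)=x}|m_0(y)|^2\xi(y)$. Let $h\in L^1(X,\mu)$ with $h\ge 0$ and $R_{m_0}h=h$ $\mu$-a.e., and assume that $m_0$ is non-singular, i.e. $m_0\neq 0$ $\mu$-a.e. Let $X_\infty=\{(x_0,x_1,\dots): r(x_{n+1})=x_n \text{ for all } n\ge 0\}$, let $\theta_n(x_0,x_1,\dots)=x_n$, equip $X_\infty$ with the $\sigma$-algebra generated by all $\theta_n$, and let $\hat r(x_0,x_1,\dots)=(r(x_0),x_0,x_1,\dots)$. There is a unique finite measure $\hat\mu$ on $X_\infty$ with $\int_{X_\infty} f\circ\theta_n\,d\hat\mu=\int_X R_{m_0}^n(fh)\,d\mu$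 for all $n\ge 0$ and all bounded measurable $f$ on $X$, and $U\xi=(m_0\circ\theta_0)\,(\xi\circ\hat r)$ defines a unitary operator $U$ on $L^2(X_\infty,\hat\mu)$. Let $\pi(g)\xi=(g\circ\theta_0)\,\xi$ for bounded measurable $g:X\to\mathbb C$. A *cocycle* is a bounded measurable function $f:X_\infty\to\mathbb C$ with $f=f\circ\hat r$ $\hat\mu$-a.e.; $M_f$ is multiplication by $f$ on $L^2(X_\infty,\hat\mu)$; $E_0(f)$ is the conditional expectation of $f$ under $\hat\mu$ given the $\sigma$-algebra generated by $\theta_0$, regarded as a function on $X$. 1. A bounded operator $A$ on $L^2(X_\infty,\hat\mu)$ commutes with $U$ and with all $\pi(g)$ if and only if $A=M_f$ for some cocycle $f$. In particular, any two such operators commute: the commutant of $(U,\pi)$ is abelian. 2. For each measurable $h_0:X\to\mathbb C$ with $R_{m_0}h_0=h_0$ $\mu$-a.e. and $|h_0|^2\le c\,h^2$ $\mu$-a.e. for some finite $c\ge 0$, there is a cocycle $f$, unique up to $\hat\mu$-a.e. equality, such that $h_0=E_0(f)\,h$ $\mu$-a.e. Conversely, for each cocycle $f$ the function $h_0:=E_0(f)\,h$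 is measurable and satisfies $R_{m_0}h_0=h_0$ $\mu$-a.e. and $|h_0|^2\le c\,h^2$ $\mu$-a.e. for some finite $c\ge0$. 3. If $h_0$ and $f$ correspond to each other as in 2, then $f=\lim_{n\to\infty}\frac{h_0}{h}\circ\theta_n$, both pointwise $\hat\mu$-a.e. and in $L^p(X_\infty,\hat\mu)$ for every $1\le p<\infty$. -/

import Mathlib

open MeasureTheory Filter Topology
open scoped ENNReal

noncomputable section

namespace RuelleDilation

/-! ### Bounded measurable functions and multiplication operators -/

section General

variable {Y : Type*} [MeasurableSpace Y]

/-- `f` is a bounded measurable complex function. -/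
def IsBddMeas (f : Y → ℂ) : Prop :=
  Measurable f ∧ ∃ C : ℝ, ∀ y, ‖f y‖ ≤ C

theorem IsBddMeas.memLp_top {f : Y → ℂ} (hf : IsBddMeas f) (ν : Measure Y) :
    MemLp f ⊤ ν := by
  obtain ⟨hm, C, hC⟩ := hf
  exact memLp_top_of_bound hm.aestronglyMeasurable C (Eventually.of_forall hC)

theorem IsBddMeas.comp {Z : Type*} [MeasurableSpace Z] {f : Y → ℂ} (hf : IsBddMeas f)
    {t : Z → Y} (ht : Measurable t) : IsBddMeas (f ∘ t) :=
  ⟨hf.1.comp ht, hf.2.imp fun _ hC z => hC (t z)⟩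

/-- The multiplication operator `M_f ξ = f ξ` on `L²(ν)`, for bounded measurable `f`. -/
def multOp (ν : Measure Y) {f : Y → ℂ} (hf : IsBddMeas f) : Lp ℂ 2 ν →L[ℂ] Lp ℂ 2 ν :=
  (ContinuousLinearMap.mul ℂ ℂ).holderL ν ⊤ 2 2 ((hf.memLp_top ν).toLp f)

theorem coeFn_multOp (ν : Measure Y) {f : Y → ℂ} (hf : IsBddMeas f) (ξ : Lp ℂ 2 ν) :
    multOp ν hf ξ =ᵐ[ν] fun y => f y * ξ y := by
  have h1 := (ContinuousLinearMap.mul ℂ ℂ).coeFn_holder (r := 2)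
    ((hf.memLp_top ν).toLp f) ξ
  filter_upwards [h1, (hf.memLp_top ν).coeFn_toLp] with y hy1 hy2
  rw [← hy2]
  exact hy1

end General

/-! ### The base system -/

section Base

variable {X : Type*}

/-- The average of `f` over the fibre of `r` above `x`:
`(1 / #r⁻¹(x)) ∑_{r(y) = x} f(y)`. -/
def fibreAvg (r : X → X) (f : X → ℂ) (x : X) : ℂ :=
  ((r ⁻¹' {x}).ncard : ℂ)⁻¹ * ∑ᶠ y ∈ r ⁻¹' {x}, f y

/-- The Ruelle operator `(R_{m₀} ξ)(x) = (1 / #r⁻¹(x)) ∑_{r(y) = x} |m₀(y)|² ξ(y)`. -/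
def ruelle (r : X → X) (m₀ : X → ℂ) (ξ : X → ℂ) : X → ℂ :=
  fibreAvg r fun y => ((‖m₀ y‖ ^ 2 : ℝ) : ℂ) * ξ y

variable [MeasurableSpace X]

/-- Strong `r`-invariance of `μ`:
`∫ f dμ = ∫ (1 / #r⁻¹(x)) ∑_{r(y) = x} f(y) dμ(x)` for all bounded measurable `f`. -/
def IsStronglyInvariant (μ : Measure X) (r : X → X) : Prop :=
  ∀ f : X → ℂ, IsBddMeas f → ∫ x, f x ∂μ = ∫ x, fibreAvg r f x ∂μ

/-- `(m₀, h)` is a Perron-Ruelle-Frobenius pair: `m₀ ∈ L^∞(μ)`, `0 ≤ h ∈ L¹(μ)`, and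
`R_{m₀} h = h`. -/
structure IsPRFPair (μ : Measure X) (r : X → X) (m₀ : X → ℂ) (h : X → ℝ) : Prop where
  memLp : MemLp m₀ ⊤ μ
  integrable : Integrable h μ
  nonneg : ∀ᵐ x ∂μ, 0 ≤ h x
  ruelle_eq : ruelle r m₀ (fun x => (h x : ℂ)) =ᵐ[μ] fun x => (h x : ℂ)

/-- `m₀` is non-singular: it does not vanish on a set of positive measure. -/
def IsNonsingular (μ : Measure X) (m₀ : X → ℂ) : Prop :=
  ∀ᵐ x ∂μ, m₀ x ≠ 0

/-- `h₀` is a measurable harmonic function, `R_{m₀} h₀ = h₀`, with `|h₀|² ≤ c h²` for some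
finite constant `c ≥ 0`. -/
structure IsDominatedHarmonic (μ : Measure X) (r : X → X) (m₀ : X → ℂ) (h : X → ℝ)
    (h₀ : X → ℂ) : Prop where
  aemeasurable : AEMeasurable h₀ μ
  ruelle_eq : ruelle r m₀ h₀ =ᵐ[μ] h₀
  bound : ∃ c : ℝ, 0 ≤ c ∧ ∀ᵐ x ∂μ, ‖h₀ x‖ ^ 2 ≤ c * h x ^ 2

end Base

/-! ### The projective limit -/

section Limit

variable {X : Type*}

/-- The projective limit `X_∞ = {(x₀, x₁, …) | r(x_{n+1}) = x_n}`. As a measurable space it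
carries the σ-algebra generated by the coordinate projections. -/
abbrev ProjLim (r : X → X) : Type _ :=
  {x : ℕ → X // ∀ n, r (x (n + 1)) = x n}

/-- The projection `θ_n` onto the `n`-th component. -/
def proj (r : X → X) (n : ℕ) (x : ProjLim r) : X := x.1 n

/-- The automorphism `(x₀, x₁, …) ↦ (r(x₀), x₀, x₁, …)` of the projective limit. -/
def shift (r : X → X) (x : ProjLim r) : ProjLim r :=
  ⟨fun n => match n with
    | 0 => r (x.1 0)
    | k + 1 => x.1 k,
   fun n => match n with
    | 0 => rfl
    | k + 1 => x.2 k⟩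

variable [MeasurableSpace X]

theorem measurable_proj (r : X → X) (n : ℕ) : Measurable (proj r n) :=
  (measurable_pi_apply n).comp measurable_subtype_coe

/-- `μhat` is the measure on the projective limit attached to `(m₀, h)`: a finite measure
with `μhat ∘ θ_n⁻¹ = ω_n` for all `n`, where `ω_n(f) = ∫ R_{m₀}^n (f h) dμ`. -/
structure IsDilationMeasure (μ : Measure X) (r : X → X) (m₀ : X → ℂ) (h : X → ℝ)
    (μhat : Measure (ProjLim r)) : Prop where
  finite : IsFiniteMeasure μhat
  marginal : ∀ (n : ℕ) (f : X → ℂ), IsBddMeas f →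
    ∫ x, f (proj r n x) ∂μhat = ∫ x, ((ruelle r m₀)^[n] fun y => f y * (h y : ℂ)) x ∂μ

/-- The representation `π(g) ξ = g(x₀) ξ` of bounded measurable functions `g` on `X`. -/
def rep (r : X → X) (μhat : Measure (ProjLim r)) {g : X → ℂ} (hg : IsBddMeas g) :
    Lp ℂ 2 μhat →L[ℂ] Lp ℂ 2 μhat :=
  multOp μhat (hg.comp (measurable_proj r 0))

/-- The commutant of `(U, π)`: all bounded operators on `L²(μhat)` that commute with `U` and
with every `π(g)`. -/
def commutant (r : X → X) (μhat : Measure (ProjLim r)) (U : Lp ℂ 2 μhat →L[ℂ] Lp ℂ 2 μhat) :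
    Set (Lp ℂ 2 μhat →L[ℂ] Lp ℂ 2 μhat) :=
  Set.centralizer (insert U {P | ∃ (g : X → ℂ) (hg : IsBddMeas g), P = rep r μhat hg})

/-- A cocycle: a bounded measurable function on the projective limit which is invariant
under the shift, almost everywhere. -/
structure IsCocycle (r : X → X) (μhat : Measure (ProjLim r)) (f : ProjLim r → ℂ) : Prop where
  bddMeas : IsBddMeas f
  invariant : f =ᵐ[μhat] f ∘ shift r

theorem exists_condExp_zero_eq (r : X → X) (μhat : Measure (ProjLim r)) (f : ProjLim r → ℂ) :
    ∃ ξ : X → ℂ, Measurable ξ ∧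
      μhat[f | MeasurableSpace.comap (proj r 0) inferInstance] = ξ ∘ proj r 0 := by
  obtain ⟨ξ, h1, h2⟩ := (stronglyMeasurable_condExp (μ := μhat) (f := f)
    (m := MeasurableSpace.comap (proj r 0) inferInstance)).exists_eq_measurable_comp
  exact ⟨ξ, h1.measurable, h2⟩

/-- `E₀(f)`, the conditional expectation of `f` given the zeroth coordinate, regarded as a
measurable function on `X`: a function with `E₀(f) ∘ θ₀` equal to the conditional
expectation of `f` given the σ-algebra generated by `θ₀`. It is unique almost everywhere for
the distribution of `θ₀`. -/
def condExpZero (r : X → X) (μhat : Measure (ProjLim r)) (f : ProjLim r → ℂ) : X → ℂ :=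
  (exists_condExp_zero_eq r μhat f).choose

end Limit

end RuelleDilation

end

open RuelleDilation

/-!
Strong invariance says that averaging over the fibres of `r` is dual to composition with `r`, so
`n` applications of the Ruelle operator integrate to the weight `W_n = ∏_{k < n} |m₀ ∘ r^k|²`:
`∫ R^n(f h) dμ = ∫ f W_n h dμ` (`IsWeightPair.integral_ruelle_iterate`). Hence a measure on the
projective limit is a dilation measure exactly when its `n`-th coordinate has the law `W_n h μ`
(`IsWeightPair.isDilationMeasure_iff`). Harmonicity of `h` makes these laws compatible with `r`; the
Ionescu-Tulcea theorem produces the measure, and since later coordinates determine earlier ones the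
laws also determine it. Fibre averages need no measurable selection: if the average of a bounded `f`
were not measurable, strong invariance would give `∫ f = 0 = ∫ (f + 1)`.

Multiplying the dilation measure by `|m₀ ∘ θ₀|²` and pushing it forward by the shift changes the law
`W_n h μ` into `W_{n+1} h μ` and so gives the same measure back (`IsWeightPair.map_shift`). This is
why `U` is isometric, and since `m₀ ≠ 0` it is onto and the shift preserves null sets. An operator
commuting with `U` and with the functions of the zeroth coordinate commutes with the functions of
every coordinate, because `U` intertwines the `(n+1)`-st with the `n`-th one; it is then a
multiplication operator (`exists_eq_multOp`), and commuting with `U` makes its symbol a cocycle.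

For a cocycle `f`, the change of variables shows that the conditional expectation of `f` given the
`n`-th coordinate is one and the same function `E₀(f)` of that coordinate for every `n`
(`IsWeightPair.integral_comp_proj_mul_cocycle`). Comparing `n = 0` and `n = 1` gives harmonicity of
`E₀(f) h`, and Lévy's upward theorem gives `E₀(f) ∘ θ_n → f`. Conversely, `h₀ = ρ h` being harmonic
means that `ρ ∘ θ_n` is a bounded martingale; its limit is the cocycle with `E₀(f) = ρ`.
-/

namespace RuelleDilation

/-! ### Bounded measurable functions -/

theorem IsBddMeas.integrable {Y : Type*} [MeasurableSpace Y] {ν : Measure Y} [IsFiniteMeasure ν]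
    {f : Y → ℂ} (hf : IsBddMeas f) : Integrable f ν := by
  obtain ⟨hm, C, hC⟩ := hf
  exact Integrable.of_bound hm.aestronglyMeasurable C (Eventually.of_forall hC)

theorem isBddMeas_indicator_one {Y : Type*} [MeasurableSpace Y] {E : Set Y}
    (hE : MeasurableSet E) : IsBddMeas (E.indicator (1 : Y → ℂ)) := by
  refine ⟨measurable_one.indicator hE, 1, fun y => ?_⟩
  by_cases hy : y ∈ E <;> simp [hy]

theorem integral_indicator_one_complex {Y : Type*} [MeasurableSpace Y] {ν : Measure Y} {E : Set Y}
    (hE : MeasurableSet E) : ∫ y, E.indicator (1 : Y → ℂ) y ∂ν = (ν.real E : ℂ) := by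
  rw [integral_indicator hE]
  simp [Measure.real]

theorem isBddMeas_indicator_norm_le {Y : Type*} [MeasurableSpace Y] {f : Y → ℂ}
    (hf : Measurable f) (C : ℝ) : IsBddMeas ({y | ‖f y‖ ≤ C}.indicator f) := by
  refine ⟨hf.indicator (measurableSet_le hf.norm measurable_const), max C 0, fun y => ?_⟩
  by_cases hy : ‖f y‖ ≤ C <;> simp [hy]

theorem exists_isBddMeas_tendsto {Y : Type*} [MeasurableSpace Y] {f : Y → ℂ}
    (hf : Measurable f) :
    ∃ F : ℕ → Y → ℂ, (∀ n, IsBddMeas (F n)) ∧ (∀ n y, ‖F n y‖ ≤ ‖f y‖) ∧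
      ∀ y, Tendsto (fun n => F n y) atTop (𝓝 (f y)) := by
  refine ⟨fun n => {y | ‖f y‖ ≤ n}.indicator f, fun n => isBddMeas_indicator_norm_le hf n,
    fun n y => norm_indicator_le_norm_self _ _, fun y => ?_⟩
  refine tendsto_const_nhds.congr' ?_
  filter_upwards [eventually_ge_atTop ⌈‖f y‖⌉₊] with n hn
  have : ‖f y‖ ≤ n := (Nat.le_ceil _).trans (by exact_mod_cast hn)
  simp [this]

/-! ### Fibre averages under strong invariance -/

section FibreAverage

variable {X : Type*} {r : X → X}

theorem fibreAvg_eq_sum (hfin : ∀ x, (r ⁻¹' {x}).Finite) (f : X → ℂ) (x : X) :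
    fibreAvg r f x = ((r ⁻¹' {x}).ncard : ℂ)⁻¹ * ∑ y ∈ (hfin x).toFinset, f y := by
  rw [fibreAvg, finsum_mem_eq_finite_toFinset_sum _ (hfin x)]

theorem ncard_fibre_pos (hr : Function.Surjective r) (hfin : ∀ x, (r ⁻¹' {x}).Finite) (x : X) :
    0 < (r ⁻¹' {x}).ncard :=
  (Set.ncard_pos (hfin x)).2 (hr x)

theorem fibreAvg_congr {f g : X → ℂ} {x : X} (h : ∀ y, r y = x → f y = g y) :
    fibreAvg r f x = fibreAvg r g x := by
  have : ∀ y ∈ r ⁻¹' {x}, f y = g y := fun y hy => h y hy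
  rw [fibreAvg, fibreAvg, finsum_mem_congr rfl this]

/-- Functions of `r y` are constants on the fibres, so they come out of the average. -/
theorem fibreAvg_comp_mul (hfin : ∀ x, (r ⁻¹' {x}).Finite) (φ f : X → ℂ) (x : X) :
    fibreAvg r (fun y => φ (r y) * f y) x = φ x * fibreAvg r f x := by
  rw [fibreAvg_congr (g := fun y => φ x * f y) fun y hy => by rw [hy], fibreAvg_eq_sum hfin,
    fibreAvg_eq_sum hfin, ← Finset.mul_sum]
  ring

theorem fibreAvg_comp (hr : Function.Surjective r) (hfin : ∀ x, (r ⁻¹' {x}).Finite)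
    (φ : X → ℂ) : fibreAvg r (φ ∘ r) = φ := by
  funext x
  rw [fibreAvg_congr (g := fun _ => φ x) fun y hy => by simp [hy], fibreAvg_eq_sum hfin,
    Finset.sum_const, ← Set.ncard_eq_toFinset_card _ (hfin x), nsmul_eq_mul, ← mul_assoc,
    inv_mul_cancel₀ (by exact_mod_cast (ncard_fibre_pos hr hfin x).ne'), one_mul]

theorem fibreAvg_add (hfin : ∀ x, (r ⁻¹' {x}).Finite) (f g : X → ℂ) (x : X) :
    fibreAvg r (fun y => f y + g y) x = fibreAvg r f x + fibreAvg r g x := by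
  simp only [fibreAvg_eq_sum hfin, Finset.sum_add_distrib, mul_add]

theorem fibreAvg_ofReal (hfin : ∀ x, (r ⁻¹' {x}).Finite) (f : X → ℝ) (x : X) :
    fibreAvg r (fun y => (f y : ℂ)) x =
      (((r ⁻¹' {x}).ncard : ℝ)⁻¹ * ∑ y ∈ (hfin x).toFinset, f y : ℝ) := by
  rw [fibreAvg_eq_sum hfin]
  push_cast
  rfl

theorem norm_fibreAvg_le (hfin : ∀ x, (r ⁻¹' {x}).Finite) (f : X → ℂ) (x : X) :
    ‖fibreAvg r f x‖ ≤ (fibreAvg r (fun y => (‖f y‖ : ℂ)) x).re := by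
  rw [fibreAvg_ofReal hfin, Complex.ofReal_re, fibreAvg_eq_sum hfin, norm_mul, norm_inv,
    Complex.norm_natCast]
  gcongr
  exact norm_sum_le _ _

theorem tendsto_fibreAvg (hfin : ∀ x, (r ⁻¹' {x}).Finite) {F : ℕ → X → ℂ} {f : X → ℂ}
    (h : ∀ y, Tendsto (fun n => F n y) atTop (𝓝 (f y))) (x : X) :
    Tendsto (fun n => fibreAvg r (F n) x) atTop (𝓝 (fibreAvg r f x)) := by
  simp only [fibreAvg_eq_sum hfin]
  exact (tendsto_finsetSum _ fun y _ => h y).const_mul _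

variable [MeasurableSpace X] {μ : Measure X} [IsProbabilityMeasure μ]

/-- If the average of `f` were not almost everywhere measurable, neither would be that of `f + 1`,
and strong invariance would give `∫ f = 0 = ∫ (f + 1)`, both right-hand integrals being
undefined. -/
theorem integrable_fibreAvg_of_bdd (hr : Function.Surjective r)
    (hfin : ∀ x, (r ⁻¹' {x}).Finite) (hμ : IsStronglyInvariant μ r) {f : X → ℂ}
    (hf : IsBddMeas f) : Integrable (fibreAvg r f) μ := by
  by_contra hn
  have hf1 : IsBddMeas fun y => f y + 1 := by
    obtain ⟨hm, C, hC⟩ := hf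
    refine ⟨hm.add_const 1, C + 1, fun y => (norm_add_le _ _).trans ?_⟩
    simpa using hC y
  have h1 : fibreAvg r (fun y => f y + 1) = fun x => fibreAvg r f x + 1 := by
    funext x
    rw [fibreAvg_add hfin]
    congr 1
    exact congrFun (fibreAvg_comp hr hfin fun _ => 1) x
  have hn1 : ¬ Integrable (fun x => fibreAvg r f x + 1) μ := fun h => hn <|
    (h.sub (integrable_const (1 : ℂ))).congr (ae_of_all _ fun x => by simp)
  have e1 := hμ f hf
  have e2 := hμ _ hf1
  rw [h1, integral_undef hn1, integral_add hf.integrable (integrable_const _), e1,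
    integral_undef hn] at e2
  simp at e2

/-- A null set meets almost no fibre. -/
theorem ae_forall_fibre (hr : Function.Surjective r) (hfin : ∀ x, (r ⁻¹' {x}).Finite)
    (hμ : IsStronglyInvariant μ r) {p : X → Prop} (hp : ∀ᵐ y ∂μ, p y) :
    ∀ᵐ x ∂μ, ∀ y, r y = x → p y := by
  set N := toMeasurable μ {y | ¬ p y} with hN
  have hNm : MeasurableSet N := measurableSet_toMeasurable _ _
  have hN0 : μ N = 0 := by rw [hN, measure_toMeasurable]; exact hp
  set g : X → ℝ := N.indicator 1 with hg
  have hg0 : ∀ y, 0 ≤ g y := fun y => Set.indicator_nonneg (by simp) y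
  have hb : IsBddMeas fun y => (g y : ℂ) := by
    refine ⟨Complex.measurable_ofReal.comp (measurable_one.indicator hNm), 1, fun y => ?_⟩
    by_cases hy : y ∈ N <;> simp [hg, hy]
  have hint := integrable_fibreAvg_of_bdd hr hfin hμ hb
  have e := hμ _ hb
  have e0 : ∫ x, (g x : ℂ) ∂μ = 0 := by
    refine integral_eq_zero_of_ae ?_
    filter_upwards [measure_eq_zero_iff_ae_notMem.1 hN0] with y hy
    simp [hg, hy]
  rw [e0] at e
  set a : X → ℝ := fun x => ((r ⁻¹' {x}).ncard : ℝ)⁻¹ * ∑ y ∈ (hfin x).toFinset, g y with ha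
  have hA : fibreAvg r (fun y => (g y : ℂ)) = fun x => (a x : ℂ) :=
    funext fun x => fibreAvg_ofReal hfin g x
  rw [hA, integral_complex_ofReal] at e
  rw [hA] at hint
  have hai : Integrable a μ := by simpa using hint.re
  have ha0 : 0 ≤ a := fun x => mul_nonneg (by positivity) (Finset.sum_nonneg fun y _ => hg0 y)
  have e' : ∫ x, a x ∂μ = 0 := by exact_mod_cast e.symm
  have := (integral_eq_zero_iff_of_nonneg ha0 hai).1 e'
  filter_upwards [this] with x hx y hy
  by_contra hpy
  have hyN : y ∈ N := subset_toMeasurable _ _ hpy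
  have hc : ((r ⁻¹' {x}).ncard : ℝ)⁻¹ ≠ 0 :=
    inv_ne_zero (by exact_mod_cast (ncard_fibre_pos hr hfin x).ne')
  have hs : ∑ y ∈ (hfin x).toFinset, g y = 0 := (mul_eq_zero.1 hx).resolve_left hc
  have := (Finset.sum_eq_zero_iff_of_nonneg fun y _ => hg0 y).1 hs y (by simpa using hy)
  simp [hg, hyN] at this

theorem fibreAvg_congr_ae (hr : Function.Surjective r) (hfin : ∀ x, (r ⁻¹' {x}).Finite)
    (hμ : IsStronglyInvariant μ r) {f g : X → ℂ} (h : f =ᵐ[μ] g) :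
    fibreAvg r f =ᵐ[μ] fibreAvg r g := by
  filter_upwards [ae_forall_fibre hr hfin hμ h] with x hx
  exact fibreAvg_congr hx

theorem lintegral_enorm_fibreAvg_le_of_bdd (hr : Function.Surjective r)
    (hfin : ∀ x, (r ⁻¹' {x}).Finite) (hμ : IsStronglyInvariant μ r) {f : X → ℂ}
    (hf : IsBddMeas f) : ∫⁻ x, ‖fibreAvg r f x‖ₑ ∂μ ≤ ∫⁻ x, ‖f x‖ₑ ∂μ := by
  have hn : IsBddMeas fun y => (‖f y‖ : ℂ) :=
    ⟨Complex.measurable_ofReal.comp hf.1.norm, hf.2.imp fun C hC y => by simpa using hC y⟩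
  have hi := integrable_fibreAvg_of_bdd hr hfin hμ hf
  have hin := integrable_fibreAvg_of_bdd hr hfin hμ hn
  rw [← ofReal_integral_norm_eq_lintegral_enorm hi,
    ← ofReal_integral_norm_eq_lintegral_enorm hf.integrable]
  refine ENNReal.ofReal_le_ofReal ?_
  calc ∫ x, ‖fibreAvg r f x‖ ∂μ ≤ ∫ x, (fibreAvg r (fun y => (‖f y‖ : ℂ)) x).re ∂μ :=
        integral_mono hi.norm hin.re fun x => norm_fibreAvg_le hfin f x
    _ = (∫ x, fibreAvg r (fun y => (‖f y‖ : ℂ)) x ∂μ).re := integral_re hin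
    _ = ∫ x, ‖f x‖ ∂μ := by
      rw [← hμ _ hn, integral_complex_ofReal, Complex.ofReal_re]

/-- The fibre average is an `L¹` contraction, by truncation and Fatou's lemma. -/
theorem lintegral_enorm_fibreAvg_le (hr : Function.Surjective r)
    (hfin : ∀ x, (r ⁻¹' {x}).Finite) (hμ : IsStronglyInvariant μ r) {f : X → ℂ}
    (hf : Measurable f) :
    AEStronglyMeasurable (fibreAvg r f) μ ∧
      ∫⁻ x, ‖fibreAvg r f x‖ₑ ∂μ ≤ ∫⁻ x, ‖f x‖ₑ ∂μ := by
  obtain ⟨F, hFb, hFle, hFt⟩ := exists_isBddMeas_tendsto hf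
  have ht := tendsto_fibreAvg hfin hFt
  have hi := fun n => integrable_fibreAvg_of_bdd hr hfin hμ (hFb n)
  refine ⟨aestronglyMeasurable_of_tendsto_ae atTop (fun n => (hi n).1) (ae_of_all _ ht), ?_⟩
  calc ∫⁻ x, ‖fibreAvg r f x‖ₑ ∂μ
      = ∫⁻ x, liminf (fun n => ‖fibreAvg r (F n) x‖ₑ) atTop ∂μ :=
        lintegral_congr fun x => ((ht x).enorm.liminf_eq).symm
    _ ≤ liminf (fun n => ∫⁻ x, ‖fibreAvg r (F n) x‖ₑ ∂μ) atTop :=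
        lintegral_liminf_le' fun n => (hi n).1.enorm
    _ ≤ liminf (fun _ : ℕ => ∫⁻ x, ‖f x‖ₑ ∂μ) atTop := by
        refine liminf_le_liminf (Eventually.of_forall fun n => ?_)
        refine (lintegral_enorm_fibreAvg_le_of_bdd hr hfin hμ (hFb n)).trans
          (lintegral_mono fun y => ?_)
        exact enorm_le_iff_norm_le.2 (hFle n y)
    _ = ∫⁻ x, ‖f x‖ₑ ∂μ := liminf_const _

/-- Strong invariance extends from bounded to integrable functions. -/
theorem integrable_fibreAvg (hr : Function.Surjective r)
    (hfin : ∀ x, (r ⁻¹' {x}).Finite) (hμ : IsStronglyInvariant μ r) {f : X → ℂ}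
    (hf : Integrable f μ) :
    Integrable (fibreAvg r f) μ ∧ ∫ x, fibreAvg r f x ∂μ = ∫ x, f x ∂μ := by
  -- the general case reduces to a measurable representative
  wlog hfm : Measurable f generalizing f with H
  · have hae := hf.1.aemeasurable.ae_eq_mk
    have hA := fibreAvg_congr_ae hr hfin hμ hae
    obtain ⟨h1, h2⟩ := H (hf.congr hae) hf.1.aemeasurable.measurable_mk
    exact ⟨h1.congr hA.symm, by rw [integral_congr_ae hA, h2, integral_congr_ae hae]⟩
  have key : ∀ {g : X → ℂ}, Measurable g → Integrable g μ → Integrable (fibreAvg r g) μ :=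
    fun hg hgi => by
      obtain ⟨h1, h2⟩ := lintegral_enorm_fibreAvg_le hr hfin hμ hg
      exact ⟨h1, h2.trans_lt hgi.2⟩
  refine ⟨key hfm hf, ?_⟩
  obtain ⟨F, hFb, hFle, hFt⟩ := exists_isBddMeas_tendsto hfm
  have t1 : Tendsto (fun n => ∫ x, F n x ∂μ) atTop (𝓝 (∫ x, f x ∂μ)) :=
    tendsto_integral_of_dominated_convergence _ (fun n => (hFb n).1.aestronglyMeasurable) hf.norm
      (fun n => ae_of_all _ (hFle n)) (ae_of_all _ hFt)
  have hn : Integrable (fun y => (‖f y‖ : ℂ)) μ := hf.norm.ofReal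
  have hnm : Measurable fun y => (‖f y‖ : ℂ) := Complex.measurable_ofReal.comp hfm.norm
  have t2 : Tendsto (fun n => ∫ x, fibreAvg r (F n) x ∂μ) atTop
      (𝓝 (∫ x, fibreAvg r f x ∂μ)) := by
    refine tendsto_integral_of_dominated_convergence
      (fun x => (fibreAvg r (fun y => (‖f y‖ : ℂ)) x).re)
      (fun n => (integrable_fibreAvg_of_bdd hr hfin hμ (hFb n)).1) (key hnm hn).re
      (fun n => ae_of_all _ fun x => (norm_fibreAvg_le hfin _ x).trans ?_)
      (ae_of_all _ (tendsto_fibreAvg hfin hFt))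
    rw [fibreAvg_ofReal hfin, fibreAvg_ofReal hfin, Complex.ofReal_re, Complex.ofReal_re]
    gcongr with y
    exact hFle n y
  refine tendsto_nhds_unique t2 (t1.congr fun n => ?_)
  exact hμ _ (hFb n)

end FibreAverage

/-! ### Iterated weights and the laws of the coordinates -/

section Weight

open scoped NNReal

variable {X : Type*}

/-- The weight `W_n(x) = ∏_{k < n} w(r^k x)`. For `w = |m₀|²` it is the density which `n`
applications of the Ruelle operator leave behind in an integral. -/
def iterWeight (r : X → X) (w : X → ℝ≥0) : ℕ → X → ℝ≥0
  | 0, _ => 1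
  | n + 1, x => iterWeight r w n (r x) * w x

theorem iterWeight_succ' (r : X → X) (w : X → ℝ≥0) (n : ℕ) (x : X) :
    iterWeight r w (n + 1) x = iterWeight r w n x * w (r^[n] x) := by
  induction n generalizing x with
  | zero => rfl
  | succ n ih =>
    rw [iterWeight, ih, iterWeight, Function.iterate_succ_apply]
    ring

variable [MeasurableSpace X]

/-- `w` and `k` are everywhere measurable and nonnegative, `w` is bounded, `k` is integrable, and
`k` is harmonic for the weighted average with weight `w`. This is what is left of a
Perron-Ruelle-Frobenius pair `(m₀, h)` after `|m₀|²` and `h` are replaced by such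
representatives. -/
structure IsWeightPair (μ : Measure X) (r : X → X) (w k : X → ℝ≥0) : Prop where
  measurable_weight : Measurable w
  bounded : ∃ C : ℝ≥0, ∀ x, w x ≤ C
  measurable_density : Measurable k
  integrable : Integrable (fun x => (k x : ℝ)) μ
  fibreAvg_eq : fibreAvg r (fun y => ((w y : ℝ) : ℂ) * ((k y : ℝ) : ℂ)) =ᵐ[μ]
    fun x => ((k x : ℝ) : ℂ)

/-- The measure `W_n k μ`, which is the law of the `n`-th coordinate under the dilation
measure. -/
noncomputable def coordLaw (μ : Measure X) (r : X → X) (w k : X → ℝ≥0) (n : ℕ) : Measure X :=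
  μ.withDensity fun x => ((iterWeight r w n x * k x : ℝ≥0) : ℝ≥0∞)

variable {r : X → X} {μ : Measure X} {w k : X → ℝ≥0}

theorem IsWeightPair.measurable_iterWeight (H : IsWeightPair μ r w k) (hm : Measurable r) (n : ℕ) :
    Measurable (iterWeight r w n) := by
  induction n with
  | zero => exact measurable_const
  | succ n ih => exact (ih.comp hm).mul H.measurable_weight

theorem IsWeightPair.exists_iterWeight_le (H : IsWeightPair μ r w k) (n : ℕ) :
    ∃ C : ℝ≥0, ∀ x, iterWeight r w n x ≤ C := by
  obtain ⟨C, hC⟩ := H.bounded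
  induction n with
  | zero => exact ⟨1, fun x => le_rfl⟩
  | succ n ih =>
    obtain ⟨D, hD⟩ := ih
    exact ⟨D * C, fun x => mul_le_mul' (hD _) (hC _)⟩

theorem isBddMeas_of_nnreal {Y : Type*} [MeasurableSpace Y] {u : Y → ℝ≥0} (hu : Measurable u)
    (hb : ∃ C : ℝ≥0, ∀ x, u x ≤ C) : IsBddMeas fun x => ((u x : ℝ) : ℂ) := by
  obtain ⟨C, hC⟩ := hb
  exact ⟨Complex.measurable_ofReal.comp hu.coe_nnreal_real, C, fun x => by
    simpa using hC x⟩

theorem IsBddMeas.mul {Y : Type*} [MeasurableSpace Y] {f g : Y → ℂ} (hf : IsBddMeas f)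
    (hg : IsBddMeas g) : IsBddMeas fun y => f y * g y := by
  obtain ⟨C, hC⟩ := hf.2
  obtain ⟨D, hD⟩ := hg.2
  refine ⟨hf.1.mul hg.1, C * D, fun y => ?_⟩
  rw [norm_mul]
  exact mul_le_mul (hC y) (hD y) (norm_nonneg _) ((norm_nonneg _).trans (hC y))

theorem IsBddMeas.integrable_mul {Y : Type*} [MeasurableSpace Y] {ν : Measure Y} {f g : Y → ℂ}
    (hf : IsBddMeas f) (hg : Integrable g ν) : Integrable (fun y => f y * g y) ν := by
  obtain ⟨hm, C, hC⟩ := hf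
  exact hg.bdd_mul hm.aestronglyMeasurable (ae_of_all _ hC)

theorem IsWeightPair.isBddMeas_iterWeight (H : IsWeightPair μ r w k) (hm : Measurable r) (n : ℕ) :
    IsBddMeas fun x => ((iterWeight r w n x : ℝ) : ℂ) :=
  isBddMeas_of_nnreal (H.measurable_iterWeight hm n) (H.exists_iterWeight_le n)

theorem IsWeightPair.isBddMeas_weight (H : IsWeightPair μ r w k) :
    IsBddMeas fun x => ((w x : ℝ) : ℂ) :=
  isBddMeas_of_nnreal H.measurable_weight H.bounded

theorem IsWeightPair.measurable_density_mul (H : IsWeightPair μ r w k) (hm : Measurable r)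
    (n : ℕ) : Measurable fun x => iterWeight r w n x * k x :=
  (H.measurable_iterWeight hm n).mul H.measurable_density

theorem IsWeightPair.integral_coordLaw (H : IsWeightPair μ r w k) (hm : Measurable r) (n : ℕ)
    (f : X → ℂ) :
    ∫ x, f x ∂(coordLaw μ r w k n) =
      ∫ x, ((iterWeight r w n x : ℝ) : ℂ) * (f x * ((k x : ℝ) : ℂ)) ∂μ := by
  rw [coordLaw, integral_withDensity_eq_integral_smul (H.measurable_density_mul hm n)]
  refine integral_congr_ae (ae_of_all _ fun x => ?_)
  simp only [NNReal.smul_def, Complex.real_smul]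
  push_cast
  ring

theorem IsWeightPair.isFiniteMeasure_coordLaw (H : IsWeightPair μ r w k) (n : ℕ) :
    IsFiniteMeasure (coordLaw μ r w k n) := by
  obtain ⟨C, hC⟩ := H.exists_iterWeight_le n
  refine isFiniteMeasure_withDensity (ne_of_lt ?_)
  calc ∫⁻ x, ((iterWeight r w n x * k x : ℝ≥0) : ℝ≥0∞) ∂μ
      ≤ ∫⁻ x, (C : ℝ≥0∞) * (k x : ℝ≥0∞) ∂μ := by
        refine lintegral_mono fun x => ?_
        rw [ENNReal.coe_mul]
        gcongr
        exact hC x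
    _ = C * ∫⁻ x, (k x : ℝ≥0∞) ∂μ := lintegral_const_mul' _ _ ENNReal.coe_ne_top
    _ < ∞ := by
        refine ENNReal.mul_lt_top ENNReal.coe_lt_top ?_
        have := H.integrable.2
        simpa [HasFiniteIntegral, enorm_eq_nnnorm] using this

theorem coordLaw_absolutelyContinuous (n : ℕ) : coordLaw μ r w k n ≪ μ :=
  withDensity_absolutelyContinuous _ _

/-- A property holds almost everywhere for every coordinate law as soon as it holds `μ`-almost
everywhere where `k` does not vanish. -/
theorem IsWeightPair.ae_coordLaw (H : IsWeightPair μ r w k) (hm : Measurable r) {p : X → Prop}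
    (hp : ∀ᵐ x ∂μ, k x ≠ 0 → p x) (n : ℕ) : ∀ᵐ x ∂(coordLaw μ r w k n), p x := by
  rw [coordLaw, ae_withDensity_iff (H.measurable_density_mul hm n).coe_nnreal_ennreal]
  filter_upwards [hp] with x hx hne
  refine hx fun h0 => hne ?_
  simp [h0]

theorem ae_of_ae_coordLaw_zero (hk : Measurable k) {p : X → Prop}
    (hp : ∀ᵐ x ∂(coordLaw μ r w k 0), p x) : ∀ᵐ x ∂μ, k x ≠ 0 → p x := by
  have hk' : Measurable fun x => ((iterWeight r w 0 x * k x : ℝ≥0) : ℝ≥0∞) := by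
    simpa [iterWeight] using hk.coe_nnreal_ennreal
  rw [coordLaw, ae_withDensity_iff hk'] at hp
  filter_upwards [hp] with x hx hne
  exact hx (by simpa [iterWeight] using hne)

theorem IsWeightPair.coordLaw_succ (H : IsWeightPair μ r w k) (hm : Measurable r) (n : ℕ) :
    coordLaw μ r w k (n + 1) =
      (coordLaw μ r w k n).withDensity fun x => (w (r^[n] x) : ℝ≥0∞) := by
  have hw : Measurable fun x => (w (r^[n] x) : ℝ≥0∞) :=
    (H.measurable_weight.comp (hm.iterate n)).coe_nnreal_ennreal
  rw [coordLaw, coordLaw, ← withDensity_mul _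
    (H.measurable_density_mul hm n).coe_nnreal_ennreal hw]
  congr 1
  funext x
  simp only [Pi.mul_apply, iterWeight_succ']
  push_cast
  ring

theorem measure_eq_of_integral_isBddMeas {Y : Type*} [MeasurableSpace Y] {ν ν' : Measure Y}
    [IsFiniteMeasure ν] [IsFiniteMeasure ν']
    (h : ∀ f : Y → ℂ, IsBddMeas f → ∫ y, f y ∂ν = ∫ y, f y ∂ν') : ν = ν' := by
  refine Measure.ext fun E hE => ?_
  have e := h _ (isBddMeas_indicator_one hE)
  rw [integral_indicator_one_complex hE, integral_indicator_one_complex hE] at e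
  exact (measureReal_eq_measureReal_iff).1 (by exact_mod_cast e)

variable [IsProbabilityMeasure μ]

/-- The transfer identity dual to composition with `r`. -/
theorem integral_mul_fibreAvg (hr : Function.Surjective r) (hfin : ∀ x, (r ⁻¹' {x}).Finite)
    (hm : Measurable r) (hμ : IsStronglyInvariant μ r) {φ F : X → ℂ} (hφ : IsBddMeas φ)
    (hF : Integrable F μ) : ∫ x, φ x * fibreAvg r F x ∂μ = ∫ y, φ (r y) * F y ∂μ := by
  have hint : Integrable (fun y => φ (r y) * F y) μ := (hφ.comp hm).integrable_mul hF
  rw [← (integrable_fibreAvg hr hfin hμ hint).2]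
  exact integral_congr_ae (ae_of_all _ fun x => (fibreAvg_comp_mul hfin φ F x).symm)

/-- The laws of the coordinates are compatible: `r` sends the law of the `(n+1)`-st coordinate to
that of the `n`-th one. This is the harmonicity of `k`. -/
theorem IsWeightPair.map_coordLaw_succ (H : IsWeightPair μ r w k) (hr : Function.Surjective r)
    (hfin : ∀ x, (r ⁻¹' {x}).Finite) (hm : Measurable r) (hμ : IsStronglyInvariant μ r) (n : ℕ) :
    (coordLaw μ r w k (n + 1)).map r = coordLaw μ r w k n := by
  have := H.isFiniteMeasure_coordLaw n
  have := H.isFiniteMeasure_coordLaw (n + 1)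
  refine measure_eq_of_integral_isBddMeas fun f hf => ?_
  have hwk : Integrable (fun y => ((w y : ℝ) : ℂ) * ((k y : ℝ) : ℂ)) μ :=
    H.isBddMeas_weight.integrable_mul H.integrable.ofReal
  rw [integral_map hm.aemeasurable hf.1.aestronglyMeasurable, H.integral_coordLaw hm,
    H.integral_coordLaw hm]
  calc _ = ∫ y, (fun x => ((iterWeight r w n x : ℝ) : ℂ) * f x) (r y) *
          (((w y : ℝ) : ℂ) * ((k y : ℝ) : ℂ)) ∂μ := by
        refine integral_congr_ae (ae_of_all _ fun y => ?_)
        simp only [iterWeight]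
        push_cast
        ring
    _ = _ := by
        rw [← integral_mul_fibreAvg hr hfin hm hμ ((H.isBddMeas_iterWeight hm n).mul hf) hwk]
        refine integral_congr_ae ?_
        filter_upwards [H.fibreAvg_eq] with x hx
        rw [hx]
        ring

theorem ruelle_ae_eq (hr : Function.Surjective r) (hfin : ∀ x, (r ⁻¹' {x}).Finite)
    (hμ : IsStronglyInvariant μ r) {m₀ : X → ℂ} (hw : ∀ᵐ x ∂μ, (w x : ℝ) = ‖m₀ x‖ ^ 2)
    {F G : X → ℂ} (hFG : F =ᵐ[μ] G) :
    ruelle r m₀ F =ᵐ[μ] fibreAvg r fun y => ((w y : ℝ) : ℂ) * G y := by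
  refine fibreAvg_congr_ae hr hfin hμ ?_
  filter_upwards [hw, hFG] with x h1 h2
  rw [h1, h2]

/-- Integrating the `n`-th iterate of the Ruelle operator amounts to integrating against `W_n`. -/
theorem IsWeightPair.integral_ruelle_iterate (H : IsWeightPair μ r w k)
    (hr : Function.Surjective r) (hfin : ∀ x, (r ⁻¹' {x}).Finite) (hm : Measurable r)
    (hμ : IsStronglyInvariant μ r) {m₀ : X → ℂ} (hw : ∀ᵐ x ∂μ, (w x : ℝ) = ‖m₀ x‖ ^ 2)
    (n : ℕ) {F : X → ℂ} (hF : Integrable F μ) :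
    ∫ x, ((ruelle r m₀)^[n] F) x ∂μ = ∫ x, ((iterWeight r w n x : ℝ) : ℂ) * F x ∂μ := by
  induction n generalizing F with
  | zero => simp [iterWeight]
  | succ n ih =>
    have hwF := H.isBddMeas_weight.integrable_mul hF
    have hae := ruelle_ae_eq hr hfin hμ hw (Filter.EventuallyEq.refl _ F)
    rw [Function.iterate_succ_apply,
      ih ((integrable_fibreAvg hr hfin hμ hwF).1.congr hae.symm)]
    calc _ = ∫ x, ((iterWeight r w n x : ℝ) : ℂ) *
            fibreAvg r (fun y => ((w y : ℝ) : ℂ) * F y) x ∂μ := by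
          refine integral_congr_ae ?_
          filter_upwards [hae] with x hx
          rw [hx]
      _ = _ := by
          rw [integral_mul_fibreAvg hr hfin hm hμ (H.isBddMeas_iterWeight hm n) hwF]
          refine integral_congr_ae (ae_of_all _ fun y => ?_)
          simp only [iterWeight]
          push_cast
          ring

/-- The dilation measure is characterized by the laws of its coordinates. -/
theorem IsWeightPair.isDilationMeasure_iff (H : IsWeightPair μ r w k)
    (hr : Function.Surjective r) (hfin : ∀ x, (r ⁻¹' {x}).Finite) (hm : Measurable r)
    (hμ : IsStronglyInvariant μ r) {m₀ : X → ℂ} {h : X → ℝ}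
    (hw : ∀ᵐ x ∂μ, (w x : ℝ) = ‖m₀ x‖ ^ 2) (hk : ∀ᵐ x ∂μ, (k x : ℝ) = h x)
    (ν : Measure (ProjLim r)) :
    IsDilationMeasure μ r m₀ h ν ↔
      IsFiniteMeasure ν ∧ ∀ n, ν.map (proj r n) = coordLaw μ r w k n := by
  have hint : Integrable (fun x => (h x : ℂ)) μ :=
    (H.integrable.congr hk).ofReal
  have key : ∀ n (f : X → ℂ), IsBddMeas f →
      ∫ x, ((ruelle r m₀)^[n] fun y => f y * (h y : ℂ)) x ∂μ =
        ∫ x, f x ∂(coordLaw μ r w k n) := fun n f hf => by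
    rw [H.integral_ruelle_iterate hr hfin hm hμ hw n (hf.integrable_mul hint),
      H.integral_coordLaw hm]
    refine integral_congr_ae ?_
    filter_upwards [hk] with x hx
    rw [hx]
  constructor
  · rintro ⟨hν, hmarg⟩
    refine ⟨hν, fun n => ?_⟩
    have := H.isFiniteMeasure_coordLaw n
    refine measure_eq_of_integral_isBddMeas fun f hf => ?_
    rw [integral_map (measurable_proj r n).aemeasurable hf.1.aestronglyMeasurable, hmarg n f hf,
      key n f hf]
  · rintro ⟨hν, hmap⟩
    refine ⟨hν, fun n f hf => ?_⟩
    rw [key n f hf, ← hmap n,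
      integral_map (measurable_proj r n).aemeasurable hf.1.aestronglyMeasurable]

end Weight

/-! ### Measures on the projective limit -/

section ProjectiveLimit

variable {X : Type*} {r : X → X}

theorem iterate_proj (k n : ℕ) (x : ProjLim r) : r^[k] (proj r (n + k) x) = proj r n x := by
  induction k with
  | zero => rfl
  | succ k ih =>
    rw [Function.iterate_succ_apply, ← ih]
    congr 1
    exact x.2 (n + k)

theorem iterate_proj_zero (n : ℕ) (x : ProjLim r) : r^[n] (proj r n x) = proj r 0 x := by
  simpa using iterate_proj n 0 x

variable [MeasurableSpace X]

/-- The filtration generated by the coordinates. The `n`-th coordinate determines all earlier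
ones, so its σ-algebra contains theirs. -/
def coordFiltration (hm : Measurable r) :
    Filtration ℕ (inferInstance : MeasurableSpace (ProjLim r)) where
  seq n := MeasurableSpace.comap (proj r n) inferInstance
  mono' n m hnm := by
    obtain ⟨k, rfl⟩ := Nat.exists_eq_add_of_le hnm
    rintro _ ⟨E, hE, rfl⟩
    refine ⟨r^[k] ⁻¹' E, hm.iterate k hE, ?_⟩
    ext x
    simp only [Set.mem_preimage, iterate_proj]
  le' n := (measurable_proj r n).comap_le

theorem iSup_comap_proj :
    ⨆ n, MeasurableSpace.comap (proj r n) inferInstance =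
      (inferInstance : MeasurableSpace (ProjLim r)) := by
  have h : (inferInstance : MeasurableSpace (ProjLim r)) =
      MeasurableSpace.comap Subtype.val MeasurableSpace.pi := rfl
  rw [h, MeasurableSpace.pi, MeasurableSpace.comap_iSup]
  refine iSup_congr fun n => ?_
  rw [MeasurableSpace.comap_comp]
  rfl

/-- The sets which depend on one coordinate only. -/
def coordSets (r : X → X) : Set (Set (ProjLim r)) :=
  {S | ∃ n, ∃ E, MeasurableSet E ∧ S = proj r n ⁻¹' E}

theorem isPiSystem_coordSets (hm : Measurable r) : IsPiSystem (coordSets r) := by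
  rintro S ⟨n, E, hE, rfl⟩ T ⟨m, F, hF, rfl⟩ -
  obtain ⟨a, ha⟩ := (coordFiltration hm).mono (le_max_left n m) _ ⟨E, hE, rfl⟩
  obtain ⟨b, hb⟩ := (coordFiltration hm).mono (le_max_right n m) _ ⟨F, hF, rfl⟩
  exact ⟨max n m, a ∩ b, ha.1.inter hb.1, by rw [Set.preimage_inter, ha.2, hb.2]⟩

theorem generateFrom_coordSets :
    (inferInstance : MeasurableSpace (ProjLim r)) =
      MeasurableSpace.generateFrom (coordSets r) := by
  refine le_antisymm ?_ (MeasurableSpace.generateFrom_le ?_)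
  · rw [← iSup_comap_proj]
    refine iSup_le fun n => ?_
    rintro _ ⟨E, hE, rfl⟩
    exact MeasurableSpace.measurableSet_generateFrom ⟨n, E, hE, rfl⟩
  · rintro _ ⟨n, E, hE, rfl⟩
    exact measurable_proj r n hE

theorem ext_of_map_proj (hm : Measurable r) {ν ν' : Measure (ProjLim r)} [IsFiniteMeasure ν]
    (h : ∀ n, ν.map (proj r n) = ν'.map (proj r n)) : ν = ν' := by
  have h' : ∀ n E, MeasurableSet E → ν (proj r n ⁻¹' E) = ν' (proj r n ⁻¹' E) := fun n E hE => by
    rw [← Measure.map_apply (measurable_proj r n) hE, h n,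
      Measure.map_apply (measurable_proj r n) hE]
  refine ext_of_generate_finite _ generateFrom_coordSets (isPiSystem_coordSets hm) ?_ ?_
  · rintro _ ⟨n, E, hE, rfl⟩
    exact h' n E hE
  · simpa using h' 0 Set.univ MeasurableSet.univ

/-- The shift is invertible: its inverse drops the zeroth coordinate. -/
def shiftEquiv (hm : Measurable r) : ProjLim r ≃ᵐ ProjLim r where
  toFun := shift r
  invFun x := ⟨fun n => x.1 (n + 1), fun n => x.2 (n + 1)⟩
  left_inv x := rfl
  right_inv x := by
    refine Subtype.ext (funext fun n => ?_)
    cases n with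
    | zero => exact x.2 0
    | succ n => rfl
  measurable_toFun := by
    refine Measurable.subtype_mk (measurable_pi_lambda _ fun n => ?_)
    cases n with
    | zero => exact hm.comp (measurable_proj r 0)
    | succ n => exact measurable_proj r n
  measurable_invFun :=
    Measurable.subtype_mk (measurable_pi_lambda _ fun n => measurable_proj r (n + 1))

theorem map_withDensity_comp {Y Z : Type*} [MeasurableSpace Y] [MeasurableSpace Z]
    {ν : Measure Y} {t : Y → Z} (ht : Measurable t) {g : Z → ℝ≥0∞} (hg : Measurable g) :
    (ν.withDensity (g ∘ t)).map t = (ν.map t).withDensity g := by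
  refine Measure.ext fun E hE => ?_
  rw [Measure.map_apply ht hE, withDensity_apply _ (ht hE), withDensity_apply _ hE,
    setLIntegral_map hE hg ht]
  rfl

open scoped NNReal in
/-- The change of variables `∫ |m₀ ∘ θ₀|² (f ∘ shift) = ∫ f` under the dilation measure. -/
theorem IsWeightPair.map_shift {μ : Measure X} [IsProbabilityMeasure μ] {w k : X → ℝ≥0}
    (H : IsWeightPair μ r w k) (hm : Measurable r) {ν : Measure (ProjLim r)} [IsFiniteMeasure ν]
    (hν : ∀ n, ν.map (proj r n) = coordLaw μ r w k n) :
    (ν.withDensity fun x => (w (proj r 0 x) : ℝ≥0∞)).map (shift r) = ν := by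
  have hs : Measurable (shift r) := (shiftEquiv hm).measurable
  set ν' := (ν.withDensity fun x => (w (proj r 0 x) : ℝ≥0∞)).map (shift r) with hν'
  have hsucc : ∀ n, ν'.map (proj r (n + 1)) = ν.map (proj r (n + 1)) := fun n => by
    have h1 : proj r (n + 1) ∘ shift r = proj r n := rfl
    have h2 : (fun x : ProjLim r => (w (proj r 0 x) : ℝ≥0∞)) =
        (fun y => (w (r^[n] y) : ℝ≥0∞)) ∘ proj r n := by
      funext x
      simp only [Function.comp_apply, iterate_proj_zero]
    have hw : Measurable fun y => (w (r^[n] y) : ℝ≥0∞) :=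
      (H.measurable_weight.comp (hm.iterate n)).coe_nnreal_ennreal
    rw [hν', Measure.map_map (measurable_proj r _) hs, h1, h2,
      map_withDensity_comp (measurable_proj r n) hw, hν, hν, ← H.coordLaw_succ hm]
  refine (ext_of_map_proj hm fun n => ?_).symm
  have h3 : proj r n = r ∘ proj r (n + 1) := funext fun x => (x.2 n).symm
  rw [h3, ← Measure.map_map hm (measurable_proj r _), ← hsucc,
    Measure.map_map hm (measurable_proj r _)]

end ProjectiveLimit

/-! ### Existence of the measure on the projective limit -/

section Existence

open ProbabilityTheory

variable {X : Type*} [MeasurableSpace X] [StandardBorelSpace X] {r : X → X}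

/-- A sequence of laws compatible with `r` is carried by the projective limit. The measure is
obtained from the Ionescu-Tulcea theorem, the transition from the `n`-th coordinate to the next
one being the disintegration of the law of `(r(y), y)` under `P (n + 1)`. -/
theorem exists_measure_map_proj_of_isProbabilityMeasure (hm : Measurable r) (P : ℕ → Measure X)
    [∀ n, IsProbabilityMeasure (P n)] (hP : ∀ n, (P (n + 1)).map r = P n) :
    ∃ ν : Measure (ProjLim r), IsFiniteMeasure ν ∧ ∀ n, ν.map (proj r n) = P n := by
  have : Nonempty X := nonempty_of_isProbabilityMeasure (P 0)
  have hg : Measurable fun y => (r y, y) := hm.prodMk measurable_id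
  set ρ : ℕ → Measure (X × X) := fun n => (P (n + 1)).map fun y => (r y, y) with hρ
  have hρp : ∀ n, IsProbabilityMeasure (ρ n) := fun n =>
    Measure.isProbabilityMeasure_map hg.aemeasurable
  have hfst : ∀ n, (ρ n).fst = P n := fun n => by
    rw [Measure.fst, hρ, Measure.map_map measurable_fst hg, ← hP n]
    rfl
  have hsnd : ∀ n, (ρ n).map Prod.snd = P (n + 1) := fun n => by
    rw [hρ, Measure.map_map measurable_snd hg]
    exact Measure.map_id
  let last : (n : ℕ) → (Finset.Iic n → X) → X := fun n x => x ⟨n, Finset.mem_Iic.2 le_rfl⟩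
  have hev : ∀ n, Measurable (last n) := fun n => measurable_pi_apply _
  let κ : (n : ℕ) → Kernel (Finset.Iic n → X) X := fun n =>
    (ρ n).condKernel.comap (last n) (hev n)
  have hκ : ∀ n, IsMarkovKernel (κ n) := fun n => by
    dsimp only [κ]
    infer_instance
  set T : Measure (ℕ → X) := Kernel.trajMeasure (X := fun _ => X) (P 0) κ with hT
  have hTp : IsProbabilityMeasure T := by rw [hT]; infer_instance
  have h0 : T.map (fun x => x 0) = P 0 := by
    have e : (fun x : ℕ → X => x 0) = last 0 ∘ Preorder.frestrictLe 0 := rfl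
    rw [e, ← Measure.map_map (hev 0) (by fun_prop), hT, Kernel.trajMeasure,
      Measure.map_comp _ _ (by fun_prop), Kernel.traj_map_frestrictLe, Kernel.partialTraj_self,
      Measure.id_comp, Measure.map_map (hev 0) (by fun_prop)]
    exact Measure.map_id
  have hpair : ∀ n, T.map (fun x => x n) = P n →
      T.map (fun x => (x n, x (n + 1))) = ρ n := fun n hn => by
    have h2 : (T.map (Preorder.frestrictLe n)) ⊗ₘ κ n =
        T.map (fun x => (Preorder.frestrictLe n x, x (n + 1))) :=
      Kernel.map_frestrictLe_trajMeasure_compProd_eq_map_trajMeasure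
        (X := fun _ => X) (μ₀ := P 0) (κ := κ) (a := n)
    have h3 : (T.map (Preorder.frestrictLe n)).map (last n) = P n := by
      rw [Measure.map_map (hev n) (by fun_prop)]
      exact hn
    have e : (fun x : ℕ → X => (x n, x (n + 1))) =
        Prod.map (last n) id ∘ fun x => (Preorder.frestrictLe n x, x (n + 1)) := rfl
    have hpm : Measurable (Prod.map (last n) (id : X → X)) := (hev n).prodMap measurable_id
    rw [e, ← Measure.map_map hpm (by fun_prop), ← h2, ← (ρ n).disintegrate (ρ n).condKernel,
      hfst, ← h3]
    have := hκ n
    refine Measure.ext fun E hE => ?_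
    rw [Measure.map_apply hpm hE, Measure.compProd_apply (hpm hE), Measure.compProd_apply hE,
      lintegral_map (Kernel.measurable_kernel_prodMk_left hE) (hev n)]
    rfl
  have hmarg : ∀ n, T.map (fun x => x n) = P n := fun n => by
    induction n with
    | zero => exact h0
    | succ n ih =>
      rw [← hsnd n, ← hpair n ih, Measure.map_map measurable_snd (by fun_prop)]
      rfl
  have hcarr : ∀ᵐ x ∂T, ∀ n, r (x (n + 1)) = x n := by
    rw [ae_all_iff]
    intro n
    have hD : MeasurableSet {p : X × X | r p.2 = p.1} :=
      measurableSet_eq_fun (hm.comp measurable_snd) measurable_fst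
    have h2 : ∀ᵐ p ∂(ρ n), r p.2 = p.1 := by
      rw [hρ, ae_map_iff hg.aemeasurable hD]
      exact ae_of_all _ fun y => rfl
    rw [← hpair n (hmarg n)] at h2
    exact ae_of_ae_map (by fun_prop) h2
  have hS : MeasurableSet {x : ℕ → X | ∀ n, r (x (n + 1)) = x n} := by
    rw [Set.ofPred_forall]
    exact MeasurableSet.iInter fun n =>
      measurableSet_eq_fun (hm.comp (measurable_pi_apply _)) (measurable_pi_apply _)
  have hemb : MeasurableEmbedding (Subtype.val : ProjLim r → ℕ → X) :=
    MeasurableEmbedding.subtype_coe hS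
  have hval : (T.comap (Subtype.val : ProjLim r → ℕ → X)).map Subtype.val = T := by
    rw [hemb.map_comap]
    refine Measure.restrict_eq_self_of_ae_mem ?_
    filter_upwards [hcarr] with x hx
    exact ⟨⟨x, hx⟩, rfl⟩
  refine ⟨T.comap Subtype.val, ?_, fun n => ?_⟩
  · refine ⟨?_⟩
    rw [hemb.comap_apply]
    exact measure_lt_top _ _
  · rw [← hmarg n]
    conv_rhs => rw [← hval]
    rw [Measure.map_map (by fun_prop) measurable_subtype_coe]
    rfl

theorem exists_measure_map_proj (hm : Measurable r) (P : ℕ → Measure X)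
    [∀ n, IsFiniteMeasure (P n)] (hP : ∀ n, (P (n + 1)).map r = P n) :
    ∃ ν : Measure (ProjLim r), IsFiniteMeasure ν ∧ ∀ n, ν.map (proj r n) = P n := by
  have hmass : ∀ n, P n Set.univ = P 0 Set.univ := fun n => by
    induction n with
    | zero => rfl
    | succ n ih => rw [← ih, ← hP n, Measure.map_apply hm MeasurableSet.univ, Set.preimage_univ]
  set c := P 0 Set.univ with hc
  by_cases hc0 : c = 0
  · refine ⟨0, inferInstance, fun n => ?_⟩
    rw [Measure.map_zero, eq_comm, ← Measure.measure_univ_eq_zero, hmass n, hc0]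
  have hct : c ≠ ∞ := measure_ne_top _ _
  have hprob : ∀ n, IsProbabilityMeasure (c⁻¹ • P n) := fun n => ⟨by
    rw [Measure.smul_apply, hmass n, smul_eq_mul, ENNReal.inv_mul_cancel hc0 hct]⟩
  obtain ⟨ν, hν, hmap⟩ := exists_measure_map_proj_of_isProbabilityMeasure hm
    (fun n => c⁻¹ • P n) fun n => by rw [Measure.map_smul, hP n]
  refine ⟨c • ν, ν.smul_finite hct, fun n => ?_⟩
  rw [Measure.map_smul, hmap n, smul_smul, ENNReal.mul_inv_cancel hc0 hct, one_smul]

end Existence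

/-! ### Weighted composition operators on `L²` -/

section WeightedComposition

open scoped NNReal

variable {Y : Type*} [MeasurableSpace Y] {ν : Measure Y}

/-- The map `e` and its inverse preserve null sets, since `u ν` and `ν` have the same ones. -/
theorem quasiMeasurePreserving_of_map_withDensity (e : Y ≃ᵐ Y) {u : Y → ℝ≥0∞} (hu : Measurable u)
    (hu0 : ∀ᵐ y ∂ν, u y ≠ 0) (he : (ν.withDensity u).map e = ν) :
    Measure.QuasiMeasurePreserving e ν ν ∧ Measure.QuasiMeasurePreserving e.symm ν ν := by
  have hac : ν ≪ ν.withDensity u := withDensity_absolutelyContinuous' hu.aemeasurable hu0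
  have hca : ν.withDensity u ≪ ν := withDensity_absolutelyContinuous _ _
  refine ⟨⟨e.measurable, ?_⟩, ⟨e.symm.measurable, ?_⟩⟩
  · conv_rhs => rw [← he]
    exact hac.map e.measurable
  · have h : ν.map e.symm = ν.withDensity u := by
      conv_lhs => rw [← he]
      rw [Measure.map_map e.symm.measurable e.measurable, e.symm_comp_self, Measure.map_id]
    rw [h]
    exact hca

theorem ae_coe_ne_zero {m : Y → ℂ} {u : Y → ℝ≥0} (hm0 : ∀ᵐ y ∂ν, m y ≠ 0)
    (hum : ∀ᵐ y ∂ν, (u y : ℝ) = ‖m y‖ ^ 2) : ∀ᵐ y ∂ν, (u y : ℝ≥0∞) ≠ 0 := by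
  filter_upwards [hm0, hum] with y h1 h2 h3
  rw [ENNReal.coe_eq_zero] at h3
  rw [h3] at h2
  exact h1 (by simpa using h2.symm)

theorem eLpNorm_mul_comp (e : Y ≃ᵐ Y) {m : Y → ℂ} {u : Y → ℝ≥0} (hu : Measurable u)
    (hum : ∀ᵐ y ∂ν, (u y : ℝ) = ‖m y‖ ^ 2)
    (he : (ν.withDensity fun y => (u y : ℝ≥0∞)).map e = ν) (ξ : Y → ℂ) :
    eLpNorm (fun y => m y * ξ (e y)) 2 ν = eLpNorm ξ 2 ν := by
  rw [eLpNorm_eq_lintegral_rpow_enorm_toReal two_ne_zero ENNReal.ofNat_ne_top,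
    eLpNorm_eq_lintegral_rpow_enorm_toReal two_ne_zero ENNReal.ofNat_ne_top]
  congr 1
  simp only [ENNReal.toReal_ofNat, ENNReal.rpow_ofNat]
  conv_rhs => rw [← he]
  rw [lintegral_map_equiv, lintegral_withDensity_eq_lintegral_mul_non_measurable _
    hu.coe_nnreal_ennreal (ae_of_all _ fun _ => ENNReal.coe_lt_top)]
  refine lintegral_congr_ae ?_
  filter_upwards [hum] with y hy
  have hy' : u y = ‖m y‖₊ ^ 2 := by
    ext
    push_cast
    exact hy
  rw [Pi.mul_apply, hy', enorm_mul, mul_pow]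
  push_cast
  rfl

/-- If `e` carries the measure `|m|² ν` to `ν` and `m` does not vanish, then `ξ ↦ m (ξ ∘ e)` is
unitary on `L²(ν)`. -/
theorem exists_unitary_mul_comp (e : Y ≃ᵐ Y) {m : Y → ℂ} (hm : AEStronglyMeasurable m ν)
    (hm0 : ∀ᵐ y ∂ν, m y ≠ 0) {u : Y → ℝ≥0} (hu : Measurable u)
    (hum : ∀ᵐ y ∂ν, (u y : ℝ) = ‖m y‖ ^ 2)
    (he : (ν.withDensity fun y => (u y : ℝ≥0∞)).map e = ν) :
    ∃ U : Lp ℂ 2 ν ≃ₗᵢ[ℂ] Lp ℂ 2 ν, ∀ ξ : Lp ℂ 2 ν, U ξ =ᵐ[ν] fun y => m y * ξ (e y) := by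
  obtain ⟨hq, hq'⟩ := quasiMeasurePreserving_of_map_withDensity e hu.coe_nnreal_ennreal
    (ae_coe_ne_zero hm0 hum) he
  have hmem : ∀ ξ : Lp ℂ 2 ν, MemLp (fun y => m y * ξ (e y)) 2 ν := fun ξ =>
    ⟨hm.mul ((Lp.aestronglyMeasurable ξ).comp_quasiMeasurePreserving hq), by
      rw [eLpNorm_mul_comp e hu hum he]; exact (Lp.memLp ξ).2⟩
  let T : Lp ℂ 2 ν →ₗᵢ[ℂ] Lp ℂ 2 ν :=
    { toFun := fun ξ => (hmem ξ).toLp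
      map_add' := fun ξ η => by
        refine Lp.ext ?_
        filter_upwards [(hmem (ξ + η)).coeFn_toLp, (hmem ξ).coeFn_toLp, (hmem η).coeFn_toLp,
          Lp.coeFn_add (hmem ξ).toLp (hmem η).toLp, hq.ae (Lp.coeFn_add ξ η)] with y h1 h2 h3 h4 h5
        rw [h1, h4, Pi.add_apply, h2, h3, h5, Pi.add_apply, mul_add]
      map_smul' := fun c ξ => by
        refine Lp.ext ?_
        filter_upwards [(hmem (c • ξ)).coeFn_toLp, (hmem ξ).coeFn_toLp,
          Lp.coeFn_smul c (hmem ξ).toLp, hq.ae (Lp.coeFn_smul c ξ)] with y h1 h2 h4 h5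
        simp only [RingHom.id_apply]
        rw [h1, h4, Pi.smul_apply, h2, h5, Pi.smul_apply, smul_eq_mul, smul_eq_mul]
        ring
      norm_map' := fun ξ => by
        change ‖(hmem ξ).toLp‖ = ‖ξ‖
        rw [Lp.norm_toLp, eLpNorm_mul_comp e hu hum he, Lp.norm_def] }
  have hT : ∀ ξ : Lp ℂ 2 ν, T ξ =ᵐ[ν] fun y => m y * ξ (e y) := fun ξ => (hmem ξ).coeFn_toLp
  have hsurj : Function.Surjective T := fun η => by
    set ζ : Y → ℂ := fun y => (m (e.symm y))⁻¹ * η (e.symm y) with hζ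
    have hback : (fun y => m y * ζ (e y)) =ᵐ[ν] η := by
      filter_upwards [hm0] with y hy
      simp only [hζ, e.symm_apply_apply]
      rw [mul_inv_cancel_left₀ hy]
    have hζm : MemLp ζ 2 ν := by
      refine ⟨?_, ?_⟩
      · exact (hm.comp_quasiMeasurePreserving hq').inv₀.mul
          ((Lp.aestronglyMeasurable η).comp_quasiMeasurePreserving hq')
      · rw [← eLpNorm_mul_comp e hu hum he ζ, eLpNorm_congr_ae hback]
        exact (Lp.memLp η).2
    refine ⟨hζm.toLp, Lp.ext ?_⟩
    filter_upwards [hT hζm.toLp, hback, hq.ae hζm.coeFn_toLp] with y h1 h2 h3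
    rw [h1, h3, h2]
  exact ⟨LinearIsometryEquiv.ofSurjective T hsurj, hT⟩

end WeightedComposition

/-! ### Operators commuting with multiplications -/

section MultiplicationOperators

variable {Y : Type*} [MeasurableSpace Y] {ν : Measure Y}

theorem multOp_mul_comm {f g : Y → ℂ} (hf : IsBddMeas f) (hg : IsBddMeas g) :
    multOp ν hf * multOp ν hg = multOp ν hg * multOp ν hf := by
  refine ContinuousLinearMap.ext fun ξ => Lp.ext ?_
  simp only [mul_apply_eq_comp]
  filter_upwards [coeFn_multOp ν hf (multOp ν hg ξ), coeFn_multOp ν hg (multOp ν hf ξ),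
    coeFn_multOp ν hg ξ, coeFn_multOp ν hf ξ] with y h1 h2 h3 h4
  rw [h1, h2, h3, h4]
  ring

theorem inner_multOp_indicator {E : Set Y} (hE : MeasurableSet E) (ξ η : Lp ℂ 2 ν) :
    inner ℂ η (multOp ν (isBddMeas_indicator_one hE) ξ) = ∫ y in E, inner ℂ (η y) (ξ y) ∂ν := by
  rw [L2.inner_def, ← integral_indicator hE]
  refine integral_congr_ae ?_
  filter_upwards [coeFn_multOp ν (isBddMeas_indicator_one hE) ξ] with y hy
  rw [hy]
  by_cases h : y ∈ E <;> simp [h]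

theorem norm_sq_multOp_indicator {E : Set Y} (hE : MeasurableSet E) (ξ : Lp ℂ 2 ν) :
    ‖multOp ν (isBddMeas_indicator_one hE) ξ‖ ^ 2 = ∫ y in E, ‖ξ y‖ ^ 2 ∂ν := by
  have h : inner ℂ (multOp ν (isBddMeas_indicator_one hE) ξ)
      (multOp ν (isBddMeas_indicator_one hE) ξ) = ((∫ y in E, ‖ξ y‖ ^ 2 ∂ν : ℝ) : ℂ) := by
    rw [inner_multOp_indicator hE, ← integral_complex_ofReal]
    refine setIntegral_congr_ae hE ?_
    filter_upwards [coeFn_multOp ν (isBddMeas_indicator_one hE) ξ] with y hy hyE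
    rw [hy]
    simp [hyE]
  rw [inner_self_eq_norm_sq_to_K] at h
  exact Complex.ofReal_injective ((Complex.ofReal_pow _ _).trans h)

variable [IsFiniteMeasure ν]

/-- A bounded operator on `L²` of a finite measure which commutes with the multiplications by the
indicators of a generating π-system is itself the multiplication by a bounded function. For fixed
`ξ` the integrable functions `ξ · conj (A* 1)` and `A ξ` have the same integral over every set
of the π-system, hence over every measurable set, hence agree. -/
theorem exists_eq_multOp {C : Set (Set Y)} (hC : (inferInstance : MeasurableSpace Y) =
      MeasurableSpace.generateFrom C) (hpi : IsPiSystem C) (A : Lp ℂ 2 ν →L[ℂ] Lp ℂ 2 ν)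
    (hA : ∀ E (hE : MeasurableSet E), E ∈ C → ∀ ξ,
      A (multOp ν (isBddMeas_indicator_one hE) ξ) = multOp ν (isBddMeas_indicator_one hE) (A ξ)) :
    ∃ (f : Y → ℂ) (hf : IsBddMeas f), A = multOp ν hf := by
  have h1mem : MemLp (fun _ : Y => (1 : ℂ)) 2 ν := memLp_const 1
  set one : Lp ℂ 2 ν := h1mem.toLp
  have hone1 : one =ᵐ[ν] fun _ => 1 := h1mem.coeFn_toLp
  set B := ContinuousLinearMap.adjoint A with hB
  have hset : ∀ ξ E, MeasurableSet E →
      ∫ y in E, inner ℂ (B one y) (ξ y) ∂ν = ∫ y in E, inner ℂ (one y) (A ξ y) ∂ν := by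
    intro ξ
    have hi1 : Integrable (fun y => inner ℂ (B one y) (ξ y)) ν := L2.integrable_inner _ _
    have hi2 : Integrable (fun y => inner ℂ (one y) (A ξ y)) ν := L2.integrable_inner _ _
    have huniv : ∫ y, inner ℂ (B one y) (ξ y) ∂ν = ∫ y, inner ℂ (one y) (A ξ y) ∂ν := by
      rw [← L2.inner_def, ← L2.inner_def, hB, ContinuousLinearMap.adjoint_inner_left]
    refine MeasurableSpace.induction_on_inter hC hpi (by simp) ?_ ?_ ?_
    · intro E hEC
      have hE : MeasurableSet E := by
        have : MeasurableSet[MeasurableSpace.generateFrom C] E :=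
          MeasurableSpace.measurableSet_generateFrom hEC
        rwa [← hC] at this
      rw [← inner_multOp_indicator hE, ← inner_multOp_indicator hE, hB,
        ContinuousLinearMap.adjoint_inner_left, hA E hE hEC]
    · intro E hE h
      have e1 := integral_add_compl hE hi1
      have e2 := integral_add_compl hE hi2
      rw [h] at e1
      exact add_left_cancel (e1.trans (huniv.trans e2.symm))
    · intro F hd hF h
      rw [integral_iUnion hF hd hi1.integrableOn, integral_iUnion hF hd hi2.integrableOn]
      exact tsum_congr h
  have hmul : ∀ ξ : Lp ℂ 2 ν, A ξ =ᵐ[ν] fun y => (starRingEnd ℂ) (B one y) * ξ y := fun ξ => by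
    have h := Integrable.ae_eq_of_forall_setIntegral_eq _ _
      (L2.integrable_inner (𝕜 := ℂ) (B one) ξ) (L2.integrable_inner (𝕜 := ℂ) one (A ξ))
      fun E hE _ => hset ξ E hE
    filter_upwards [h, hone1] with y hy h1
    rw [h1] at hy
    simpa [mul_comm] using hy.symm
  set g : Y → ℂ := fun y => (starRingEnd ℂ) (B one y) with hg
  have hgm : Measurable g :=
    Complex.continuous_conj.measurable.comp (Lp.stronglyMeasurable _).measurable
  -- testing `A` on the indicator of `{‖A‖ < |g|}` shows that this set is null
  have hbound : ∀ᵐ y ∂ν, ‖g y‖ ≤ ‖A‖ := by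
    have hE : MeasurableSet {y | ‖A‖ < ‖g y‖} := measurableSet_lt measurable_const hgm.norm
    set E := {y | ‖A‖ < ‖g y‖} with hEdef
    set M := multOp ν (isBddMeas_indicator_one hE) with hM
    have hAM : A (M one) = M (A one) := by
      refine Lp.ext ?_
      filter_upwards [hmul (M one), hmul one, coeFn_multOp ν (isBddMeas_indicator_one hE) one,
        coeFn_multOp ν (isBddMeas_indicator_one hE) (A one)] with y a1 a2 a3 a4
      rw [a1, a4, a2, a3]
      ring
    have hle : ‖M (A one)‖ ^ 2 ≤ ‖A‖ ^ 2 * ‖M one‖ ^ 2 := by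
      rw [← hAM, ← mul_pow]
      exact pow_le_pow_left₀ (norm_nonneg _) (A.le_opNorm _) 2
    rw [hM, norm_sq_multOp_indicator hE, norm_sq_multOp_indicator hE] at hle
    have hA1 : A one =ᵐ[ν] g := by
      filter_upwards [hmul one, hone1] with y a1 a2
      rw [a1, a2, mul_one]
    have e1 : ∫ y in E, ‖A one y‖ ^ 2 ∂ν = ∫ y in E, ‖g y‖ ^ 2 ∂ν :=
      integral_congr_ae (ae_restrict_of_ae (hA1.fun_comp fun z => ‖z‖ ^ 2))
    have e2 : ∫ y in E, ‖one y‖ ^ 2 ∂ν = ∫ y in E, (1 : ℝ) ∂ν :=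
      integral_congr_ae (ae_restrict_of_ae (by filter_upwards [hone1] with y hy; simp [hy]))
    rw [e1, e2, ← integral_const_mul] at hle
    have hgi : Integrable (fun y => ‖g y‖ ^ 2) ν := by
      have : MemLp g 2 ν := (Lp.memLp (A one)).ae_eq hA1
      exact this.integrable_norm_pow two_ne_zero
    have hci : Integrable (fun _ : Y => ‖A‖ ^ 2 * 1) ν := integrable_const _
    have hsub : Integrable (fun y => ‖g y‖ ^ 2 - ‖A‖ ^ 2 * 1) ν := hgi.sub hci
    have hzero := (integral_eq_zero_iff_of_nonneg_ae (μ := ν.restrict E)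
      (f := fun y => ‖g y‖ ^ 2 - ‖A‖ ^ 2 * 1) ?_ hsub.integrableOn).1 ?_
    · rw [Filter.EventuallyEq, ae_restrict_iff' hE] at hzero
      filter_upwards [hzero] with y hy
      by_contra hlt
      have hlt' : ‖A‖ < ‖g y‖ := not_le.1 hlt
      have := hy hlt'
      simp only [Pi.zero_apply] at this
      nlinarith [norm_nonneg A]
    · filter_upwards [ae_restrict_mem hE] with y hy
      have hlt' : ‖A‖ < ‖g y‖ := hy
      simp only [Pi.zero_apply]
      nlinarith [norm_nonneg A]
    · refine le_antisymm ?_ ?_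
      · rw [integral_sub hgi.integrableOn hci.integrableOn]
        linarith
      · refine setIntegral_nonneg hE fun y hy => ?_
        have hlt' : ‖A‖ < ‖g y‖ := hy
        nlinarith [norm_nonneg A]
  have hfb := isBddMeas_indicator_norm_le hgm ‖A‖
  refine ⟨_, hfb, ContinuousLinearMap.ext fun ξ => Lp.ext ?_⟩
  filter_upwards [hmul ξ, coeFn_multOp ν hfb ξ, hbound] with y a1 a2 a3
  rw [a1, a2, Set.indicator_of_mem (show y ∈ {y | ‖g y‖ ≤ ‖A‖} from a3)]

end MultiplicationOperators

/-! ### Complex-valued bounded martingales -/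

section Martingale

variable {Ω : Type*} {m0 : MeasurableSpace Ω} {ν : Measure Ω} [IsFiniteMeasure ν]
  {ℱ : Filtration ℕ m0}

/-- Lévy's upward theorem for complex functions. -/
theorem tendsto_ae_condExp_complex (hsup : ⨆ n, ℱ n = m0) {f : Ω → ℂ} (hf : Measurable f)
    (hfi : Integrable f ν) :
    ∀ᵐ x ∂ν, Tendsto (fun n => (ν[f | ℱ n]) x) atTop (𝓝 (f x)) := by
  have key : ∀ L : ℂ →L[ℝ] ℝ,
      ∀ᵐ x ∂ν, Tendsto (fun n => L ((ν[f | ℱ n]) x)) atTop (𝓝 (L (f x))) := fun L => by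
    have hm : StronglyMeasurable[⨆ n, ℱ n] (L ∘ f) := by
      rw [hsup]
      exact (L.measurable.comp hf).stronglyMeasurable
    have hc : ∀ᵐ x ∂ν, ∀ n, L ((ν[f | ℱ n]) x) = (ν[L ∘ f | ℱ n]) x :=
      ae_all_iff.2 fun n => L.comp_condExp_comm hfi
    filter_upwards [(L.integrable_comp hfi).tendsto_ae_condExp hm, hc] with x h1 h2
    simp only [h2]
    exact h1
  filter_upwards [key Complex.reCLM, key Complex.imCLM] with x h1 h2
  have h := (Complex.continuous_ofReal.tendsto _).comp h1
  have h' := ((Complex.continuous_ofReal.tendsto _).comp h2).mul_const Complex.I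
  have h3 := h.add h'
  simpa [Function.comp_def, Complex.re_add_im] using h3

theorem exists_tendsto_ae_of_martingale {F : ℕ → Ω → ℂ} (hF : Martingale F ℱ ν) {C : ℝ}
    (hC : ∀ n x, ‖F n x‖ ≤ C) :
    ∃ f : Ω → ℂ, IsBddMeas f ∧ ∀ᵐ x ∂ν, Tendsto (fun n => F n x) atTop (𝓝 (f x)) := by
  have key : ∀ L : ℂ →L[ℝ] ℝ, (∀ z, ‖L z‖ ≤ ‖z‖) →
      ∀ᵐ x ∂ν, ∃ c, Tendsto (fun n => L (F n x)) atTop (𝓝 c) := fun L hL => by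
    have hLF : Martingale (fun n x => L (F n x)) ℱ ν := by
      refine ⟨fun n => L.continuous.comp_stronglyMeasurable (hF.1 n), fun i j hij => ?_⟩
      filter_upwards [L.comp_condExp_comm (m := ℱ i) (hF.integrable j), hF.2 i j hij] with x h1 h2
      rw [← h2]
      exact h1.symm
    refine hLF.submartingale.exists_ae_tendsto_of_bdd
      (R := (ν Set.univ * ENNReal.ofReal C).toNNReal) fun n => ?_
    rw [ENNReal.coe_toNNReal (ENNReal.mul_ne_top (measure_ne_top _ _) ENNReal.ofReal_ne_top)]
    refine (eLpNorm_le_of_ae_bound (ae_of_all _ fun x => (hL _).trans (hC n x))).trans ?_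
    simp
  have hex : ∀ᵐ x ∂ν, ∃ l : ℂ, Tendsto (fun n => F n x) atTop (𝓝 l) := by
    filter_upwards [key Complex.reCLM Complex.abs_re_le_norm,
      key Complex.imCLM Complex.abs_im_le_norm] with x ⟨a, ha⟩ ⟨b, hb⟩
    refine ⟨a + b * Complex.I, ?_⟩
    have h := (Complex.continuous_ofReal.tendsto _).comp ha
    have h' := ((Complex.continuous_ofReal.tendsto _).comp hb).mul_const Complex.I
    simpa [Function.comp_def, Complex.re_add_im] using h.add h'
  obtain ⟨g, hgm, hg⟩ := measurable_limit_of_tendsto_metrizable_ae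
    (fun n => (hF.integrable n).1.aemeasurable) hex
  refine ⟨{y | ‖g y‖ ≤ C}.indicator g, isBddMeas_indicator_norm_le hgm C, ?_⟩
  filter_upwards [hg] with x hx
  have hle : ‖g x‖ ≤ C := le_of_tendsto' hx.norm fun n => hC n x
  rwa [Set.indicator_of_mem (show x ∈ {y | ‖g y‖ ≤ C} from hle)]

theorem tendsto_eLpNorm_sub_of_bdd {F : ℕ → Ω → ℂ} {f : Ω → ℂ} {C D : ℝ}
    (hF : ∀ n, AEStronglyMeasurable (F n) ν) (hf : AEStronglyMeasurable f ν)
    (hC : ∀ n, ∀ᵐ x ∂ν, ‖F n x‖ ≤ C) (hD : ∀ᵐ x ∂ν, ‖f x‖ ≤ D)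
    (h : ∀ᵐ x ∂ν, Tendsto (fun n => F n x) atTop (𝓝 (f x))) {p : ℝ≥0∞} (hp : 1 ≤ p)
    (hp' : p ≠ ∞) : Tendsto (fun n => eLpNorm (fun x => F n x - f x) p ν) atTop (𝓝 0) := by
  have hp0 : p ≠ 0 := (zero_lt_one.trans_le hp).ne'
  have hpr : 0 < p.toReal := ENNReal.toReal_pos hp0 hp'
  simp only [eLpNorm_eq_lintegral_rpow_enorm_toReal hp0 hp']
  have hlim : Tendsto (fun n => ∫⁻ x, ‖F n x - f x‖ₑ ^ p.toReal ∂ν) atTop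
      (𝓝 (∫⁻ _, 0 ∂ν)) := by
    refine tendsto_lintegral_of_dominated_convergence'
      (fun _ => ENNReal.ofReal (C + D) ^ p.toReal)
      (fun n => ((hF n).sub hf).enorm.pow_const _) (fun n => ?_) ?_ ?_
    · filter_upwards [hC n, hD] with x h1 h2
      refine ENNReal.rpow_le_rpow ?_ hpr.le
      rw [← ofReal_norm]
      exact ENNReal.ofReal_le_ofReal ((norm_sub_le _ _).trans (add_le_add h1 h2))
    · rw [lintegral_const]
      exact ENNReal.mul_ne_top (ENNReal.rpow_ne_top_of_nonneg hpr.le ENNReal.ofReal_ne_top)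
        (measure_ne_top _ _)
    · filter_upwards [h] with x hx
      have h1 : Tendsto (fun n => ‖F n x - f x‖ₑ) atTop (𝓝 0) := by
        have := (hx.sub_const (f x)).enorm
        simpa using this
      have h2 := (ENNReal.continuous_rpow_const (y := p.toReal)).tendsto 0 |>.comp h1
      simpa [Function.comp_def, ENNReal.zero_rpow_of_pos hpr] using h2
  rw [lintegral_zero] at hlim
  have h3 := (ENNReal.continuous_rpow_const (y := 1 / p.toReal)).tendsto 0 |>.comp hlim
  simpa [Function.comp_def, ENNReal.zero_rpow_of_pos (inv_pos.2 hpr)] using h3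

end Martingale

/-! ### Cocycles and harmonic functions -/

section Cocycle

open scoped NNReal

variable {X : Type*} [MeasurableSpace X] {r : X → X} {μ : Measure X} {w k : X → ℝ≥0}
  {ν : Measure (ProjLim r)}

theorem integral_comp_proj (hν : ∀ n, ν.map (proj r n) = coordLaw μ r w k n) (n : ℕ) {φ : X → ℂ}
    (hφ : Measurable φ) : ∫ x, φ (proj r n x) ∂ν = ∫ x, φ x ∂(coordLaw μ r w k n) := by
  rw [← hν n, integral_map (measurable_proj r n).aemeasurable hφ.aestronglyMeasurable]

theorem ae_comp_proj (hν : ∀ n, ν.map (proj r n) = coordLaw μ r w k n) {n : ℕ} {p : X → Prop}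
    (hp : ∀ᵐ x ∂(coordLaw μ r w k n), p x) : ∀ᵐ x ∂ν, p (proj r n x) := by
  rw [← hν n] at hp
  exact ae_of_ae_map (measurable_proj r n).aemeasurable hp

/-- Integration over a set that depends on the `n`-th coordinate is integration against a bounded
function of it. -/
theorem setIntegral_preimage_proj (n : ℕ) {E : Set X} (hE : MeasurableSet E)
    (f : ProjLim r → ℂ) :
    ∫ x in proj r n ⁻¹' E, f x ∂ν = ∫ x, E.indicator (1 : X → ℂ) (proj r n x) * f x ∂ν := by
  rw [← integral_indicator (measurable_proj r n hE)]
  refine integral_congr_ae (ae_of_all _ fun x => ?_)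
  by_cases hx : proj r n x ∈ E <;> simp [Set.indicator, hx]

theorem IsWeightPair.integral_coordLaw_succ (H : IsWeightPair μ r w k) (hm : Measurable r) (n : ℕ)
    (f : X → ℂ) :
    ∫ x, f x ∂(coordLaw μ r w k (n + 1)) =
      ∫ x, ((w (r^[n] x) : ℝ) : ℂ) * f x ∂(coordLaw μ r w k n) := by
  have hw : Measurable fun x => w (r^[n] x) := H.measurable_weight.comp (hm.iterate n)
  rw [H.coordLaw_succ hm, integral_withDensity_eq_integral_smul hw]
  refine integral_congr_ae (ae_of_all _ fun x => ?_)
  simp only [NNReal.smul_def, Complex.real_smul]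

/-- `ξ` is a version of `E₀(f)`: `f` and `ξ ∘ θ₀` have the same integral against every bounded
measurable function of the zeroth coordinate. -/
def IsCondExpZero (ν : Measure (ProjLim r)) (f : ProjLim r → ℂ) (ξ : X → ℂ) : Prop :=
  ∀ g : X → ℂ, IsBddMeas g →
    ∫ x, g (proj r 0 x) * f x ∂ν = ∫ x, g (proj r 0 x) * ξ (proj r 0 x) ∂ν

/-- `condExpZero` has a bounded version. The two may differ where `k = 0`, a null set for the law
of the zeroth coordinate. -/
theorem exists_isCondExpZero [IsFiniteMeasure ν]
    (hk : Measurable k)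
    (hν : ∀ n, ν.map (proj r n) = coordLaw μ r w k n) {f : ProjLim r → ℂ} (hf : IsBddMeas f) :
    ∃ ξ : X → ℂ, IsBddMeas ξ ∧ IsCondExpZero ν f ξ ∧
      ∀ᵐ x ∂μ, k x ≠ 0 → condExpZero r ν f x = ξ x := by
  obtain ⟨hξm, hξ⟩ := (exists_condExp_zero_eq r ν f).choose_spec
  change Measurable (condExpZero r ν f) at hξm
  change _ = condExpZero r ν f ∘ proj r 0 at hξ
  set ζ := condExpZero r ν f with hζ
  obtain ⟨hfm, C, hC⟩ := id hf
  have hle : MeasurableSpace.comap (proj r 0) inferInstance ≤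
      (inferInstance : MeasurableSpace (ProjLim r)) := (measurable_proj r 0).comap_le
  have hD : MeasurableSet {x | ‖ζ x‖ ≤ C} := measurableSet_le hξm.norm measurable_const
  have hbd : ∀ᵐ x ∂(coordLaw μ r w k 0), ‖ζ x‖ ≤ C := by
    rw [← hν 0, ae_map_iff (measurable_proj r 0).aemeasurable hD]
    have := ae_bdd_norm_condExp_of_ae_bdd_norm (m := MeasurableSpace.comap (proj r 0) inferInstance)
      (ae_of_all ν hC)
    rw [hξ] at this
    exact this
  set ξ : X → ℂ := {x | ‖ζ x‖ ≤ C}.indicator ζ with hξdef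
  have hξb : IsBddMeas ξ := isBddMeas_indicator_norm_le hξm C
  have heq : ∀ᵐ x ∂(coordLaw μ r w k 0), ζ x = ξ x := by
    filter_upwards [hbd] with x hx
    rw [hξdef, Set.indicator_of_mem (show x ∈ {x | ‖ζ x‖ ≤ C} from hx)]
  refine ⟨ξ, hξb, fun g hg => ?_, ae_of_ae_coordLaw_zero hk heq⟩
  obtain ⟨D, hgD⟩ := hg.2
  have hpull := condExp_stronglyMeasurable_bilin_of_bound (ContinuousLinearMap.mul ℝ ℂ) hle
    (f := fun x => g (proj r 0 x)) (g := f) (μ := ν)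
    (hg.1.comp (comap_measurable (proj r 0))).stronglyMeasurable hf.integrable D
    (ae_of_all _ fun x => hgD _)
  simp only [ContinuousLinearMap.mul_apply'] at hpull
  rw [← integral_condExp hle (f := fun x => g (proj r 0 x) * f x)]
  refine integral_congr_ae ?_
  filter_upwards [hpull, ae_comp_proj hν heq] with x h1 h2
  rw [h1, hξ, ← h2]
  rfl

variable [IsProbabilityMeasure μ]

/-- A bounded function `ρ` for which `ρ k` is harmonic is a martingale along the coordinates. -/
theorem IsWeightPair.martingale_of_harmonic (H : IsWeightPair μ r w k)
    (hr : Function.Surjective r) (hfin : ∀ x, (r ⁻¹' {x}).Finite) (hm : Measurable r)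
    (hμ : IsStronglyInvariant μ r) [IsFiniteMeasure ν]
    (hν : ∀ n, ν.map (proj r n) = coordLaw μ r w k n) {ρ : X → ℂ} (hρ : IsBddMeas ρ)
    (hharm : fibreAvg r (fun y => ((w y : ℝ) : ℂ) * (ρ y * ((k y : ℝ) : ℂ))) =ᵐ[μ]
      fun x => ρ x * ((k x : ℝ) : ℂ)) :
    Martingale (fun n x => ρ (proj r n x)) (coordFiltration hm) ν := by
  have hint : Integrable (fun y => ((w y : ℝ) : ℂ) * (ρ y * ((k y : ℝ) : ℂ))) μ :=
    H.isBddMeas_weight.integrable_mul (hρ.integrable_mul H.integrable.ofReal)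
  refine martingale_of_setIntegral_eq_succ (fun n => ?_)
    (fun n => (hρ.comp (measurable_proj r n)).integrable) fun n s hs => ?_
  · exact (hρ.1.comp (comap_measurable (proj r n))).stronglyMeasurable
  · obtain ⟨E, hE, rfl⟩ := hs
    have hb := isBddMeas_indicator_one (Y := X) hE
    rw [setIntegral_preimage_proj n hE, setIntegral_preimage_proj n hE,
      integral_comp_proj hν n (hb.mul hρ).1]
    have e : ∀ x : ProjLim r, E.indicator (1 : X → ℂ) (proj r n x) * ρ (proj r (n + 1) x) =
        (fun y => E.indicator (1 : X → ℂ) (r y) * ρ y) (proj r (n + 1) x) := fun x => by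
      have : proj r n x = r (proj r (n + 1) x) := (x.2 n).symm
      rw [this]
    simp only [e]
    rw [integral_comp_proj hν (n + 1) (φ := fun y => E.indicator (1 : X → ℂ) (r y) * ρ y)
      ((hb.comp hm).mul hρ).1, H.integral_coordLaw hm,
      H.integral_coordLaw hm]
    have h1 := integral_mul_fibreAvg hr hfin hm hμ ((H.isBddMeas_iterWeight hm n).mul hb) hint
    calc _ = ∫ x, ((iterWeight r w n x : ℝ) : ℂ) * E.indicator (1 : X → ℂ) x *
            fibreAvg r (fun y => ((w y : ℝ) : ℂ) * (ρ y * ((k y : ℝ) : ℂ))) x ∂μ := by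
          refine integral_congr_ae ?_
          filter_upwards [hharm] with x hx
          rw [hx]
          ring
      _ = _ := by
          rw [h1]
          refine integral_congr_ae (ae_of_all _ fun y => ?_)
          simp only [iterWeight]
          push_cast
          ring

theorem IsWeightPair.integral_eq_integral_shift (H : IsWeightPair μ r w k) (hm : Measurable r)
    [IsFiniteMeasure ν] (hν : ∀ n, ν.map (proj r n) = coordLaw μ r w k n) (F : ProjLim r → ℂ) :
    ∫ x, F x ∂ν = ∫ x, ((w (proj r 0 x) : ℝ) : ℂ) * F (shift r x) ∂ν := by
  have hmap : (ν.withDensity fun x => (w (proj r 0 x) : ℝ≥0∞)).map (shiftEquiv hm) = ν :=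
    H.map_shift hm hν
  have hw : Measurable fun x : ProjLim r => w (proj r 0 x) :=
    H.measurable_weight.comp (measurable_proj r 0)
  conv_lhs => rw [← hmap]
  rw [integral_map_equiv, integral_withDensity_eq_integral_smul hw]
  refine integral_congr_ae (ae_of_all _ fun x => ?_)
  simp only [NNReal.smul_def, Complex.real_smul]
  rfl

/-- For a cocycle, the conditional expectation given the `n`-th coordinate is the same function of
that coordinate for every `n`. -/
theorem IsWeightPair.integral_comp_proj_mul_cocycle (H : IsWeightPair μ r w k)
    (hm : Measurable r) [IsFiniteMeasure ν]
    (hν : ∀ n, ν.map (proj r n) = coordLaw μ r w k n) {f : ProjLim r → ℂ}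
    (hf : IsCocycle r ν f) {ξ : X → ℂ} (hξ : IsBddMeas ξ) (h0 : IsCondExpZero ν f ξ)
    (n : ℕ) {g : X → ℂ} (hg : IsBddMeas g) :
    ∫ x, g (proj r n x) * f x ∂ν = ∫ x, g (proj r n x) * ξ (proj r n x) ∂ν := by
  induction n generalizing g with
  | zero => exact h0 g hg
  | succ n ih =>
    have hwg : IsBddMeas fun y => ((w (r^[n] y) : ℝ) : ℂ) * g y :=
      (H.isBddMeas_weight.comp (hm.iterate n)).mul hg
    have e := ih hwg
    rw [integral_comp_proj hν n (φ := fun y => ((w (r^[n] y) : ℝ) : ℂ) * g y * ξ y)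
      (hwg.mul hξ).1] at e
    rw [integral_comp_proj hν (n + 1) (φ := fun y => g y * ξ y) (hg.mul hξ).1,
      H.integral_coordLaw_succ hm, H.integral_eq_integral_shift hm hν]
    simp only [← mul_assoc]
    rw [← e]
    refine integral_congr_ae ?_
    filter_upwards [hf.invariant] with x hx
    have h1 : proj r (n + 1) (shift r x) = proj r n x := rfl
    rw [h1, iterate_proj_zero, hx]
    rfl

theorem IsWeightPair.condExp_cocycle (H : IsWeightPair μ r w k)
    (hm : Measurable r) [IsFiniteMeasure ν]
    (hν : ∀ n, ν.map (proj r n) = coordLaw μ r w k n) {f : ProjLim r → ℂ}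
    (hf : IsCocycle r ν f) {ξ : X → ℂ} (hξ : IsBddMeas ξ) (h0 : IsCondExpZero ν f ξ) (n : ℕ) :
    (fun x => ξ (proj r n x)) =ᵐ[ν] ν[f | coordFiltration hm n] := by
  refine ae_eq_condExp_of_forall_setIntegral_eq ((coordFiltration hm).le n) hf.bddMeas.integrable
    (fun s _ _ => (hξ.comp (measurable_proj r n)).integrable.integrableOn) (fun s hs _ => ?_) ?_
  · obtain ⟨E, hE, rfl⟩ := hs
    rw [setIntegral_preimage_proj n hE, setIntegral_preimage_proj n hE]
    exact (H.integral_comp_proj_mul_cocycle hm hν hf hξ h0 n (isBddMeas_indicator_one hE)).symm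
  · exact (hξ.1.comp (comap_measurable (proj r n))).stronglyMeasurable.aestronglyMeasurable

/-- `E₀(f) k` is harmonic for a cocycle `f`: a function of `x₀ = r(x₁)` can be integrated against
`f` through either coordinate, and `E₀(f)` represents `f` in both. -/
theorem IsWeightPair.harmonic_of_cocycle (H : IsWeightPair μ r w k)
    (hr : Function.Surjective r) (hfin : ∀ x, (r ⁻¹' {x}).Finite) (hm : Measurable r)
    (hμ : IsStronglyInvariant μ r) [IsFiniteMeasure ν]
    (hν : ∀ n, ν.map (proj r n) = coordLaw μ r w k n) {f : ProjLim r → ℂ}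
    (hf : IsCocycle r ν f) {ξ : X → ℂ} (hξ : IsBddMeas ξ) (h0 : IsCondExpZero ν f ξ) :
    fibreAvg r (fun y => ((w y : ℝ) : ℂ) * (ξ y * ((k y : ℝ) : ℂ))) =ᵐ[μ]
      fun x => ξ x * ((k x : ℝ) : ℂ) := by
  have hξk : Integrable (fun x => ξ x * ((k x : ℝ) : ℂ)) μ :=
    hξ.integrable_mul H.integrable.ofReal
  have hint : Integrable (fun y => ((w y : ℝ) : ℂ) * (ξ y * ((k y : ℝ) : ℂ))) μ :=
    H.isBddMeas_weight.integrable_mul hξk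
  refine Integrable.ae_eq_of_forall_setIntegral_eq _ _ (integrable_fibreAvg hr hfin hμ hint).1
    hξk fun E hE _ => ?_
  have hb := isBddMeas_indicator_one (Y := X) hE
  have hset : ∀ G : X → ℂ, ∫ x in E, G x ∂μ = ∫ x, E.indicator (1 : X → ℂ) x * G x ∂μ :=
    fun G => by
      rw [← integral_indicator hE]
      refine integral_congr_ae (ae_of_all _ fun x => ?_)
      by_cases hx : x ∈ E <;> simp [hx]
  rw [hset, hset, integral_mul_fibreAvg hr hfin hm hμ hb hint]
  have e0 := h0 _ hb
  have e1 := H.integral_comp_proj_mul_cocycle hm hν hf hξ h0 1 (hb.comp hm)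
  have h01 : ∀ x : ProjLim r, (E.indicator (1 : X → ℂ) ∘ r) (proj r 1 x) =
      E.indicator (1 : X → ℂ) (proj r 0 x) := fun x => congrArg _ (x.2 0)
  rw [integral_comp_proj hν 1 (φ := fun y => (E.indicator (1 : X → ℂ) ∘ r) y * ξ y)
    ((hb.comp hm).mul hξ).1, H.integral_coordLaw hm] at e1
  rw [integral_comp_proj hν 0 (φ := fun y => E.indicator (1 : X → ℂ) y * ξ y)
    (hb.mul hξ).1, H.integral_coordLaw hm] at e0
  simp only [h01] at e1
  rw [e0] at e1
  simp only [iterWeight, Function.comp_apply, NNReal.coe_one, Complex.ofReal_one, one_mul]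
    at e1
  simp only [mul_assoc] at e1 ⊢
  rw [e1]
  refine integral_congr_ae (ae_of_all _ fun y => ?_)
  ring

end Cocycle

/-! ### The commutant -/

section Commutant

variable {X : Type*} [MeasurableSpace X] {r : X → X} {ν : Measure (ProjLim r)}
  {U : Lp ℂ 2 ν ≃ₗᵢ[ℂ] Lp ℂ 2 ν} {m₀ : X → ℂ}

/-- `U` intertwines multiplication by `φ` with multiplication by `φ ∘ shift`. -/
theorem unitary_multOp (hq : Measure.QuasiMeasurePreserving (shift r) ν ν)
    (hU : ∀ ξ : Lp ℂ 2 ν, U ξ =ᵐ[ν] fun x => m₀ (proj r 0 x) * ξ (shift r x))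
    {φ ψ : ProjLim r → ℂ} (hφ : IsBddMeas φ) (hψ : IsBddMeas ψ)
    (hφψ : ψ =ᵐ[ν] φ ∘ shift r) (ξ : Lp ℂ 2 ν) :
    U (multOp ν hφ ξ) = multOp ν hψ (U ξ) := by
  refine Lp.ext ?_
  filter_upwards [hU (multOp ν hφ ξ), hU ξ, coeFn_multOp ν hψ (U ξ),
    hq.ae (coeFn_multOp ν hφ ξ), hφψ] with x h1 h2 h3 h4 h5
  rw [h1, h3, h2, h4, h5, Function.comp_apply]
  ring

/-- An operator in the commutant commutes with the bounded functions of any coordinate, because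
conjugation by `U` turns functions of the `(n+1)`-st coordinate into functions of the `n`-th. -/
theorem commute_multOp_proj (hq : Measure.QuasiMeasurePreserving (shift r) ν ν)
    (hU : ∀ ξ : Lp ℂ 2 ν, U ξ =ᵐ[ν] fun x => m₀ (proj r 0 x) * ξ (shift r x))
    {A : Lp ℂ 2 ν →L[ℂ] Lp ℂ 2 ν}
    (hA : A ∈ commutant r ν (U.toContinuousLinearEquiv : Lp ℂ 2 ν →L[ℂ] Lp ℂ 2 ν))
    (n : ℕ) {g : X → ℂ} (hg : IsBddMeas g) (ξ : Lp ℂ 2 ν) :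
    A (multOp ν (hg.comp (measurable_proj r n)) ξ) =
      multOp ν (hg.comp (measurable_proj r n)) (A ξ) := by
  have hAU : ∀ ξ, A (U ξ) = U (A ξ) := fun ξ =>
    (DFunLike.congr_fun (hA _ (Set.mem_insert _ _)) ξ).symm
  induction n generalizing ξ with
  | zero =>
    exact (DFunLike.congr_fun (hA _ (Set.mem_insert_of_mem _ ⟨g, hg, rfl⟩)) ξ).symm
  | succ n ih =>
    have hint : ∀ ξ, U (multOp ν (hg.comp (measurable_proj r (n + 1))) ξ) =
        multOp ν (hg.comp (measurable_proj r n)) (U ξ) := fun ξ =>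
      unitary_multOp hq hU _ _ (ae_of_all _ fun x => rfl) ξ
    apply U.injective
    rw [← hAU, hint, ih, hAU, hint]

theorem mem_commutant_iff [IsFiniteMeasure ν] (hm : Measurable r)
    (hq : Measure.QuasiMeasurePreserving (shift r) ν ν)
    (hm₀ : ∀ᵐ x ∂ν, m₀ (proj r 0 x) ≠ 0)
    (hU : ∀ ξ : Lp ℂ 2 ν, U ξ =ᵐ[ν] fun x => m₀ (proj r 0 x) * ξ (shift r x))
    (A : Lp ℂ 2 ν →L[ℂ] Lp ℂ 2 ν) :
    A ∈ commutant r ν (U.toContinuousLinearEquiv : Lp ℂ 2 ν →L[ℂ] Lp ℂ 2 ν) ↔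
      ∃ (f : ProjLim r → ℂ) (hf : IsCocycle r ν f), A = multOp ν hf.bddMeas := by
  constructor
  · intro hA
    obtain ⟨f, hf, rfl⟩ := exists_eq_multOp generateFrom_coordSets (isPiSystem_coordSets hm) A
      fun E hE hEC ξ => by
        obtain ⟨n, F, hF, rfl⟩ := hEC
        exact commute_multOp_proj hq hU hA n (isBddMeas_indicator_one hF) ξ
    refine ⟨f, ⟨hf, ?_⟩, rfl⟩
    have h1mem : MemLp (fun _ : ProjLim r => (1 : ℂ)) 2 ν := memLp_const 1
    have hfs : IsBddMeas (f ∘ shift r) := hf.comp (shiftEquiv hm).measurable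
    have h1 : multOp ν hf (U h1mem.toLp) = multOp ν hfs (U h1mem.toLp) := by
      rw [← unitary_multOp hq hU hf hfs (EventuallyEq.refl _ _)]
      exact (DFunLike.congr_fun (hA _ (Set.mem_insert _ _)) h1mem.toLp).symm
    have h2 := coeFn_multOp ν hf (U h1mem.toLp)
    rw [h1] at h2
    filter_upwards [h2, coeFn_multOp ν hfs (U h1mem.toLp), hU h1mem.toLp, hm₀,
      hq.ae h1mem.coeFn_toLp] with x a1 a2 a3 a4 a5
    rw [a2, a3, a5, mul_one] at a1
    exact (mul_right_cancel₀ a4 a1).symm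
  · rintro ⟨f, hf, rfl⟩
    rintro B (rfl | ⟨g, hg, rfl⟩)
    · exact ContinuousLinearMap.ext fun ξ =>
        unitary_multOp hq hU hf.bddMeas hf.bddMeas hf.invariant ξ
    · exact multOp_mul_comm _ _

end Commutant

/-! ### Representatives of the pair, and dominated harmonic functions -/

section Pair

open scoped NNReal

variable {X : Type*} [MeasurableSpace X] {r : X → X} {μ : Measure X} [IsProbabilityMeasure μ]

theorem IsPRFPair.exists_isWeightPair {m₀ : X → ℂ} {h : X → ℝ} (hpair : IsPRFPair μ r m₀ h)
    (hr : Function.Surjective r) (hfin : ∀ x, (r ⁻¹' {x}).Finite)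
    (hμ : IsStronglyInvariant μ r) :
    ∃ w k : X → ℝ≥0, IsWeightPair μ r w k ∧ (∀ᵐ x ∂μ, (w x : ℝ) = ‖m₀ x‖ ^ 2) ∧
      ∀ᵐ x ∂μ, (k x : ℝ) = h x := by
  obtain ⟨C, hC⟩ : ∃ C : ℝ, ∀ᵐ x ∂μ, ‖m₀ x‖ ≤ C := by
    refine ⟨(eLpNormEssSup m₀ μ).toReal, ?_⟩
    have hfin := hpair.memLp.2.ne
    rw [eLpNorm_exponent_top] at hfin
    filter_upwards [ae_le_eLpNormEssSup (f := m₀) (μ := μ)] with x hx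
    rw [← toReal_enorm]
    exact ENNReal.toReal_mono hfin hx
  have hm₀ := hpair.memLp.1
  have hh := hpair.integrable.1
  set w : X → ℝ≥0 := fun x => min (‖hm₀.mk m₀ x‖₊ ^ 2) (Real.toNNReal C ^ 2) with hw
  set k : X → ℝ≥0 := fun x => Real.toNNReal (hh.mk h x) with hk
  have hw' : ∀ᵐ x ∂μ, (w x : ℝ) = ‖m₀ x‖ ^ 2 := by
    filter_upwards [hm₀.ae_eq_mk, hC] with x h1 h2
    have hle : ‖m₀ x‖₊ ≤ Real.toNNReal C := by
      rw [← NNReal.coe_le_coe]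
      exact h2.trans (Real.le_coe_toNNReal C)
    simp only [hw]
    rw [← h1, min_eq_left (pow_le_pow_left₀ zero_le hle 2)]
    simp
  have hk' : ∀ᵐ x ∂μ, (k x : ℝ) = h x := by
    filter_upwards [hh.ae_eq_mk, hpair.nonneg] with x h1 h2
    simp only [hk]
    rw [← h1, Real.coe_toNNReal _ h2]
  refine ⟨w, k, ⟨?_, ⟨Real.toNNReal C ^ 2, fun x => min_le_right _ _⟩, ?_, ?_, ?_⟩, hw', hk'⟩
  · exact (hm₀.stronglyMeasurable_mk.measurable.nnnorm.pow_const 2).min measurable_const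
  · exact hh.stronglyMeasurable_mk.measurable.real_toNNReal
  · exact hpair.integrable.congr (hk'.mono fun x hx => hx.symm)
  · have hkc : (fun x => (h x : ℂ)) =ᵐ[μ] fun x => ((k x : ℝ) : ℂ) :=
      hk'.mono fun x hx => congrArg ((↑) : ℝ → ℂ) hx.symm
    exact (ruelle_ae_eq hr hfin hμ hw' hkc).symm.trans (hpair.ruelle_eq.trans hkc)

/-- A dominated harmonic function is `ρ k` for a bounded function `ρ`. -/
theorem IsDominatedHarmonic.exists_eq_mul {m₀ : X → ℂ} {h : X → ℝ} {w k : X → ℝ≥0}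
    (hr : Function.Surjective r) (hfin : ∀ x, (r ⁻¹' {x}).Finite)
    (hμ : IsStronglyInvariant μ r) (hkm : Measurable k)
    (hw : ∀ᵐ x ∂μ, (w x : ℝ) = ‖m₀ x‖ ^ 2) (hk : ∀ᵐ x ∂μ, (k x : ℝ) = h x) {h₀ : X → ℂ}
    (H₀ : IsDominatedHarmonic μ r m₀ h h₀) :
    ∃ ρ : X → ℂ, IsBddMeas ρ ∧ (h₀ =ᵐ[μ] fun x => ρ x * ((k x : ℝ) : ℂ)) ∧
      fibreAvg r (fun y => ((w y : ℝ) : ℂ) * (ρ y * ((k y : ℝ) : ℂ))) =ᵐ[μ]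
        fun x => ρ x * ((k x : ℝ) : ℂ) := by
  obtain ⟨c, hc0, hc⟩ := H₀.bound
  set q := H₀.aemeasurable.mk h₀ with hq
  set ζ : X → ℂ := fun x => q x / ((k x : ℝ) : ℂ) with hζ
  have hζm : Measurable ζ := H₀.aemeasurable.measurable_mk.div
    (Complex.measurable_ofReal.comp hkm.coe_nnreal_real)
  have heq : h₀ =ᵐ[μ] fun x => {x | ‖ζ x‖ ≤ √c}.indicator ζ x * ((k x : ℝ) : ℂ) := by
    filter_upwards [H₀.aemeasurable.ae_eq_mk, hc, hk] with x h1 h2 h3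
    have h4 : ‖h₀ x‖ ≤ √c * k x := by
      rw [← h3] at h2
      refine abs_le_of_sq_le_sq' ?_ (by positivity) |>.2
      rwa [mul_pow, Real.sq_sqrt hc0]
    by_cases hkx : k x = 0
    · simp only [hkx, NNReal.coe_zero, mul_zero, norm_le_zero_iff] at h4
      simp [hkx, h4]
    · have hpos : (0 : ℝ) < k x := NNReal.coe_pos.2 (pos_iff_ne_zero.2 hkx)
      have hmem : x ∈ {x | ‖ζ x‖ ≤ √c} := by
        change ‖q x / ((k x : ℝ) : ℂ)‖ ≤ √c
        rw [hq, ← h1, norm_div, Complex.norm_real, Real.norm_of_nonneg hpos.le,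
          div_le_iff₀ hpos]
        exact h4
      rw [Set.indicator_of_mem hmem]
      simp only [hζ]
      rw [div_mul_cancel₀ _ (Complex.ofReal_ne_zero.2 hpos.ne'), hq, ← h1]
  exact ⟨{x | ‖ζ x‖ ≤ √c}.indicator ζ, isBddMeas_indicator_norm_le hζm _, heq,
    (ruelle_ae_eq hr hfin hμ hw heq).symm.trans (H₀.ruelle_eq.trans heq)⟩

end Pair

/-! ### Cocycles as limits of harmonic functions -/

section Correspondence

open scoped NNReal

variable {X : Type*} [MeasurableSpace X] {r : X → X} {μ : Measure X} [IsProbabilityMeasure μ]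
  {w k : X → ℝ≥0} {ν : Measure (ProjLim r)} [IsFiniteMeasure ν]

/-- A bounded function `ρ` with `ρ k` harmonic is `E₀(f)` for the cocycle `f = lim ρ ∘ θ_n`. -/
theorem IsWeightPair.exists_cocycle (H : IsWeightPair μ r w k)
    (hr : Function.Surjective r) (hfin : ∀ x, (r ⁻¹' {x}).Finite) (hm : Measurable r)
    (hμ : IsStronglyInvariant μ r) (hν : ∀ n, ν.map (proj r n) = coordLaw μ r w k n)
    (hq : Measure.QuasiMeasurePreserving (shift r) ν ν) {ρ : X → ℂ} (hρ : IsBddMeas ρ)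
    (hharm : fibreAvg r (fun y => ((w y : ℝ) : ℂ) * (ρ y * ((k y : ℝ) : ℂ))) =ᵐ[μ]
      fun x => ρ x * ((k x : ℝ) : ℂ)) :
    ∃ f : ProjLim r → ℂ, IsCocycle r ν f ∧ ∀ᵐ x ∂μ, k x ≠ 0 → condExpZero r ν f x = ρ x := by
  have hmart := H.martingale_of_harmonic hr hfin hm hμ hν hρ hharm
  obtain ⟨C, hC⟩ := hρ.2
  obtain ⟨f, hf, hlim⟩ := exists_tendsto_ae_of_martingale hmart fun n x => hC _
  refine ⟨f, ⟨hf, ?_⟩, ?_⟩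
  · filter_upwards [hlim, hq.ae hlim] with x h1 h2
    -- along the shifted point the sequence is the same one, delayed by one step
    have h3 : Tendsto (fun n => ρ (proj r n x)) atTop (𝓝 (f (shift r x))) :=
      (tendsto_add_atTop_iff_nat 1).2 h2
    exact tendsto_nhds_unique h1 h3
  · obtain ⟨hξm, hξ⟩ := (exists_condExp_zero_eq r ν f).choose_spec
    change Measurable (condExpZero r ν f) at hξm
    change _ = condExpZero r ν f ∘ proj r 0 at hξ
    refine ae_of_ae_coordLaw_zero (r := r) (w := w) H.measurable_density ?_
    rw [← hν 0, ae_map_iff (measurable_proj r 0).aemeasurable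
      (measurableSet_eq_fun hξm hρ.1)]
    have hce : (fun x => ρ (proj r 0 x)) =ᵐ[ν] ν[f | coordFiltration hm 0] := by
      refine ae_eq_condExp_of_forall_setIntegral_eq ((coordFiltration hm).le 0) hf.integrable
        (fun s _ _ => (hρ.comp (measurable_proj r 0)).integrable.integrableOn)
        (fun s hs _ => ?_)
        (hρ.1.comp (comap_measurable (proj r 0))).stronglyMeasurable.aestronglyMeasurable
      have ht : Tendsto (fun n => ∫ x in s, ρ (proj r n x) ∂ν) atTop (𝓝 (∫ x in s, f x ∂ν)) :=
        tendsto_integral_of_dominated_convergence (fun _ => C)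
          (fun n => (hρ.1.comp (measurable_proj r n)).aestronglyMeasurable)
          (integrable_const _) (fun n => ae_of_all _ fun x => hC _) (ae_restrict_of_ae hlim)
      refine tendsto_nhds_unique (tendsto_const_nhds.congr fun n => ?_) ht
      exact hmart.setIntegral_eq (Nat.zero_le n) hs
    have hce' : ν[f | coordFiltration hm 0] = condExpZero r ν f ∘ proj r 0 := hξ
    filter_upwards [hce] with x hx
    rw [hx, hce']
    rfl

/-- If `h₀ = E₀(f) h`, then `h₀ / h` read at the `n`-th coordinate is, up to null sets, a bounded
function of it which converges to the cocycle `f`. -/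
theorem IsWeightPair.tendsto_cocycle (H : IsWeightPair μ r w k) (hm : Measurable r)
    (hν : ∀ n, ν.map (proj r n) = coordLaw μ r w k n) {h : X → ℝ}
    (hk : ∀ᵐ x ∂μ, (k x : ℝ) = h x) {f : ProjLim r → ℂ} (hf : IsCocycle r ν f) {h₀ : X → ℂ}
    (h₀f : h₀ =ᵐ[μ] fun x => condExpZero r ν f x * (h x : ℂ)) :
    ∃ ξ : X → ℂ, IsBddMeas ξ ∧
      (∀ n, (fun x => h₀ (proj r n x) / (h (proj r n x) : ℂ)) =ᵐ[ν] fun x => ξ (proj r n x)) ∧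
      ∀ᵐ x ∂ν, Tendsto (fun n => h₀ (proj r n x) / (h (proj r n x) : ℂ)) atTop (𝓝 (f x)) := by
  obtain ⟨ξ, hξb, hξ0, hξ⟩ := exists_isCondExpZero H.measurable_density hν hf.bddMeas
  have hquot : ∀ n,
      (fun x => h₀ (proj r n x) / (h (proj r n x) : ℂ)) =ᵐ[ν] fun x => ξ (proj r n x) := by
    intro n
    refine ae_comp_proj hν (p := fun y => h₀ y / (h y : ℂ) = ξ y) (H.ae_coordLaw hm ?_ n)
    filter_upwards [hξ, hk, h₀f] with x h1 h2 h3 hne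
    have hne' : (h x : ℂ) ≠ 0 := by
      rw [← h2]
      exact_mod_cast hne
    rw [h3, mul_div_cancel_right₀ _ hne', h1 hne]
  refine ⟨ξ, hξb, hquot, ?_⟩
  have hsup : ⨆ n, coordFiltration hm n = (inferInstance : MeasurableSpace (ProjLim r)) :=
    iSup_comap_proj
  filter_upwards [tendsto_ae_condExp_complex hsup hf.bddMeas.1 hf.bddMeas.integrable,
    ae_all_iff.2 fun n => H.condExp_cocycle hm hν hf hξb hξ0 n, ae_all_iff.2 hquot]
    with x h1 h2 h3
  refine h1.congr fun n => ?_
  rw [h3 n, ← h2 n]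

end Correspondence

end RuelleDilation

theorem corollary6p3
    {X : Type*} [MetricSpace X] [CompactSpace X] [MeasurableSpace X] [BorelSpace X]
    (r : X → X) (hr_surj : Function.Surjective r) (hr_meas : Measurable r)
    (hr_fin : ∀ x, (r ⁻¹' {x}).Finite)
    (μ : Measure X) [IsProbabilityMeasure μ] (hμ : IsStronglyInvariant μ r)
    (m₀ : X → ℂ) (h : X → ℝ) (hpair : IsPRFPair μ r m₀ h) (hm₀ : IsNonsingular μ m₀) :
    (∃! μhat : Measure (ProjLim r), IsDilationMeasure μ r m₀ h μhat) ∧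
    ∀ μhat : Measure (ProjLim r), IsDilationMeasure μ r m₀ h μhat →
      -- the unitary `U ξ = m₀(x₀) ξ ∘ shift`
      ∃ U : Lp ℂ 2 μhat ≃ₗᵢ[ℂ] Lp ℂ 2 μhat,
        (∀ ξ : Lp ℂ 2 μhat, U ξ =ᵐ[μhat] fun x => m₀ (proj r 0 x) * ξ (shift r x)) ∧
        -- the commutant consists exactly of the multiplications by cocycles
        (∀ A : Lp ℂ 2 μhat →L[ℂ] Lp ℂ 2 μhat,
          A ∈ commutant r μhat (U.toContinuousLinearEquiv : Lp ℂ 2 μhat →L[ℂ] Lp ℂ 2 μhat) ↔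
            ∃ (f : ProjLim r → ℂ) (hf : IsCocycle r μhat f), A = multOp μhat hf.bddMeas) ∧
        -- the commutant is abelian
        (∀ A ∈ commutant r μhat (U.toContinuousLinearEquiv : Lp ℂ 2 μhat →L[ℂ] Lp ℂ 2 μhat),
          ∀ B ∈ commutant r μhat (U.toContinuousLinearEquiv : Lp ℂ 2 μhat →L[ℂ] Lp ℂ 2 μhat),
            A * B = B * A) ∧
        -- every dominated harmonic function comes from a cocycle, unique almost everywhere
        (∀ h₀ : X → ℂ, IsDominatedHarmonic μ r m₀ h h₀ →
          ∃ f : ProjLim r → ℂ,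
            (IsCocycle r μhat f ∧ h₀ =ᵐ[μ] fun x => condExpZero r μhat f x * (h x : ℂ)) ∧
            ∀ f' : ProjLim r → ℂ, IsCocycle r μhat f' →
              h₀ =ᵐ[μ] (fun x => condExpZero r μhat f' x * (h x : ℂ)) → f' =ᵐ[μhat] f) ∧
        -- every cocycle gives a dominated harmonic function
        (∀ f : ProjLim r → ℂ, IsCocycle r μhat f →
          IsDominatedHarmonic μ r m₀ h fun x => condExpZero r μhat f x * (h x : ℂ)) ∧
        -- the cocycle is the limit of `(h₀ / h) ∘ θ_n`, almost everywhere and in `L^p`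
        (∀ (h₀ : X → ℂ) (f : ProjLim r → ℂ), IsDominatedHarmonic μ r m₀ h h₀ →
          IsCocycle r μhat f → h₀ =ᵐ[μ] (fun x => condExpZero r μhat f x * (h x : ℂ)) →
            (∀ᵐ x ∂μhat, Tendsto (fun n => h₀ (proj r n x) / (h (proj r n x) : ℂ)) atTop
              (𝓝 (f x))) ∧
            ∀ p : ℝ≥0∞, 1 ≤ p → p ≠ ⊤ →
              (∀ n, MemLp (fun x => h₀ (proj r n x) / (h (proj r n x) : ℂ)) p μhat) ∧
              Tendsto (fun n => eLpNorm
                (fun x => h₀ (proj r n x) / (h (proj r n x) : ℂ) - f x) p μhat) atTop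
                (𝓝 0)) := by
  obtain ⟨w, k, H, hw, hk⟩ := hpair.exists_isWeightPair hr_surj hr_fin hμ
  have hiff := H.isDilationMeasure_iff hr_surj hr_fin hr_meas hμ hw hk
  have hfinite := fun n => H.isFiniteMeasure_coordLaw n
  refine ⟨?_, fun ν hνD => ?_⟩
  · obtain ⟨ν, hνf, hν⟩ := exists_measure_map_proj hr_meas (coordLaw μ r w k)
      (H.map_coordLaw_succ hr_surj hr_fin hr_meas hμ)
    refine ⟨ν, (hiff ν).2 ⟨hνf, hν⟩, fun ν' hν' => ?_⟩
    obtain ⟨_, hmap⟩ := (hiff ν').1 hν'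
    exact ext_of_map_proj hr_meas fun n => (hmap n).trans (hν n).symm
  obtain ⟨hνf, hν⟩ := (hiff ν).1 hνD
  have hqmp0 : Measure.QuasiMeasurePreserving (proj r 0) ν μ :=
    ⟨measurable_proj r 0, by rw [hν 0]; exact coordLaw_absolutelyContinuous 0⟩
  have hm₀ν : ∀ᵐ x ∂ν, m₀ (proj r 0 x) ≠ 0 := hqmp0.ae hm₀
  have hwν : ∀ᵐ x ∂ν, (w (proj r 0 x) : ℝ) = ‖m₀ (proj r 0 x)‖ ^ 2 := hqmp0.ae hw
  have hwm : Measurable fun x : ProjLim r => w (proj r 0 x) :=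
    H.measurable_weight.comp (measurable_proj r 0)
  have hshift := H.map_shift hr_meas hν
  have hq : Measure.QuasiMeasurePreserving (shift r) ν ν :=
    (quasiMeasurePreserving_of_map_withDensity (shiftEquiv hr_meas) hwm.coe_nnreal_ennreal
      (ae_coe_ne_zero hm₀ν hwν) hshift).1
  obtain ⟨U, hU⟩ : ∃ U : Lp ℂ 2 ν ≃ₗᵢ[ℂ] Lp ℂ 2 ν,
      ∀ ξ : Lp ℂ 2 ν, U ξ =ᵐ[ν] fun x => m₀ (proj r 0 x) * ξ (shift r x) :=
    exists_unitary_mul_comp (shiftEquiv hr_meas)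
      (hpair.memLp.1.comp_quasiMeasurePreserving hqmp0) hm₀ν hwm hwν hshift
  have hcomm := mem_commutant_iff hr_meas hq hm₀ν hU
  refine ⟨U, hU, hcomm, ?_, fun h₀ H₀ => ?_, fun f hf => ?_, fun h₀ f H₀ hf h₀f => ?_⟩
  · intro A hA B hB
    obtain ⟨f, hf, rfl⟩ := (hcomm A).1 hA
    obtain ⟨g, hg, rfl⟩ := (hcomm B).1 hB
    exact multOp_mul_comm _ _
  · obtain ⟨ρ, hρ, h₀ρ, hharm⟩ := H₀.exists_eq_mul hr_surj hr_fin hμ H.measurable_density hw hk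
    obtain ⟨f, hf, hfρ⟩ := H.exists_cocycle hr_surj hr_fin hr_meas hμ hν hq hρ hharm
    have h₀f : h₀ =ᵐ[μ] fun x => condExpZero r ν f x * (h x : ℂ) := by
      filter_upwards [h₀ρ, hfρ, hk] with x h1 h2 h3
      rw [h1, ← h3]
      by_cases hkx : k x = 0
      · simp [hkx]
      · rw [h2 hkx]
    refine ⟨f, ⟨hf, h₀f⟩, fun f' hf' h₀f' => ?_⟩
    -- both cocycles are the limit of `(h₀ / h) ∘ θ_n`
    obtain ⟨-, -, -, hlim⟩ := H.tendsto_cocycle hr_meas hν hk hf h₀f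
    obtain ⟨-, -, -, hlim'⟩ := H.tendsto_cocycle hr_meas hν hk hf' h₀f'
    filter_upwards [hlim, hlim'] with x h1 h2
    exact tendsto_nhds_unique h2 h1
  · obtain ⟨ξ, hξb, hξ0, hξ⟩ := exists_isCondExpZero H.measurable_density hν hf.bddMeas
    obtain ⟨C, hC⟩ := hξb.2
    have heq : (fun x => condExpZero r ν f x * (h x : ℂ)) =ᵐ[μ]
        fun x => ξ x * ((k x : ℝ) : ℂ) := by
      filter_upwards [hξ, hk] with x h1 h2
      rw [← h2]
      by_cases hkx : k x = 0
      · simp [hkx]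
      · rw [h1 hkx]
    refine ⟨?_, ?_, C ^ 2, sq_nonneg C, ?_⟩
    · exact ((hξb.integrable_mul H.integrable.ofReal).1.aemeasurable).congr heq.symm
    · exact (ruelle_ae_eq hr_surj hr_fin hμ hw heq).trans
        ((H.harmonic_of_cocycle hr_surj hr_fin hr_meas hμ hν hf hξb hξ0).trans heq.symm)
    · filter_upwards [heq, hk] with x h1 h2
      rw [h1, norm_mul, mul_pow, Complex.norm_real, h2, Real.norm_eq_abs, sq_abs]
      gcongr
      exact hC x
  · obtain ⟨ξ, hξb, hquot, hlim⟩ := H.tendsto_cocycle hr_meas hν hk hf h₀f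
    refine ⟨hlim, fun p hp hp' => ?_⟩
    obtain ⟨C, hC⟩ := hξb.2
    obtain ⟨D, hD⟩ := hf.bddMeas.2
    have hmeas : ∀ n, AEStronglyMeasurable
        (fun x => h₀ (proj r n x) / (h (proj r n x) : ℂ)) ν := fun n =>
      (hξb.1.comp (measurable_proj r n)).aestronglyMeasurable.congr (hquot n).symm
    have hbd : ∀ n, ∀ᵐ x ∂ν, ‖h₀ (proj r n x) / (h (proj r n x) : ℂ)‖ ≤ C := fun n => by
      filter_upwards [hquot n] with x hx
      rw [hx]
      exact hC _
    exact ⟨fun n => MemLp.of_bound (hmeas n) C (hbd n),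
      tendsto_eLpNorm_sub_of_bdd hmeas hf.bddMeas.1.aestronglyMeasurable hbd (ae_of_all _ hD)
        hlim hp hp'⟩
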